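/- Let $n\ge 3$. Let $K_n$ be the space of complex symmetric $n\times n$ matrices $\underline s=(s_{ij})$ with $s_{ii}=0$ and $\sum_j s_{ij}=0$ for every $i$. For a diagonal $(i,j)$, $i<j$, of the $n$-gon with vertices $1,\dots,n$ put $X_{ij}(\underline s)=\sum_{i\le a<b\le j-1}s_{ab}$. Let $(\mathcal M_{0,n})_{>0}$ be the positive part of the moduli space of $n$ distinct points $\sigma_1,\dots,\sigma_n$ of $\mathbb P^1$ modulo $\mathrm{PGL}(2)$, identified with $\mathbb R_{>0}^{n-3}$ through $$\sigma_1=0,\quad \sigma_2=1,\quad \sigma_k=1+x_1+\cdots+x_{k-2}\ (3\le k\le n-1),\quad \sigma_n=\infty ;$$ let $\Omega=\frac{dx_1}{x_1}\wedge\cdots\wedge\frac{dx_{n-3}}{x_{n-3}}$ be its Parke–Taylor form, and let $$u_{ij}=\frac{(\sigma_i-\sigma_{j+1})(\sigma_{i+1}-\sigma_j)}{(\sigma_i-\sigma_j)(\sigma_{i+1}-\sigma_{j+1})}>0$$ (indices modulo $n$) be the dihedral coordinates. Write $\phi_X=\prod_{(i,j)}u_{ij}^{X_{ij}}$, the product over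 all diagonals, and $$J_n(\underline s)=\int_{(\mathcal M_{0,n})_{>0}}\phi_{X(\underline s)}\,\Omega .$$ **Theorem.** The integral $J_n(\underline s)$ converges absolutely whenever $\operatorname{Re}X_{ij}(\underline s)>0$ for all diagonals $(i,j)$, and as a function on this region it has a holomorphic continuation, again denoted $J_n$, to the connected open set $\{\underline s\in K_n: X_{ij}(\underline s)\notin\{0,-1,-2,\dots\}\text{ for all diagonals }(i,j)\}$. Let $I_n(\underline s)=(\alpha')^{n-3}J_n(\alpha'\underline s)$ be the tree-level $n$-point open superstring amplitude. Then its field theory limit is the planar $\phi^3$-amplitude: for every $\underline s\in K_n$ with $X_{ij}(\underline s)\ne 0$ for all diagonals $(i,j)$, $$\lim_{\alpha'\to 0}I_n(\underline s)=A_n^{\phi^3}(\underline s):=\sum_{\mathcal D}\ \prod_{(i,j)\in\mathcal D}\frac{1}{X_{ij}(\underline s)},$$ where $\mathcal D$ runs over the triangulations of the $n$-gon (maximal sets of pairwise non-crossing diagonals), equivalently over the cubic planar trees with $n$ leaves, and $\alpha'\to0$ through nonzero complex values (in particular through positive reals). -/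

import Mathlib

open Set Filter Topology MeasureTheory

noncomputable section

/-- Massless kinematic space `K_n`: complex symmetric `n × n` matrices `s = (s_{ij})` with zero
diagonal and all row sums zero. (Written as functions of two indices, so that it is a normed
space.) -/
def kinematicSpace (n : ℕ) : Submodule ℂ (Fin n → Fin n → ℂ) where
  carrier := {s | (∀ i j, s i j = s j i) ∧ (∀ i, s i i = 0) ∧ ∀ i, ∑ j, s i j = 0}
  zero_mem' := by simp
  add_mem' := by
    rintro s t ⟨hs1, hs2, hs3⟩ ⟨ht1, ht2, ht3⟩
    refine ⟨fun i j => ?_, fun i => ?_, fun i => ?_⟩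
    · simp [hs1 i j, ht1 i j]
    · simp [hs2 i, ht2 i]
    · simp [Finset.sum_add_distrib, hs3 i, ht3 i]
  smul_mem' := by
    rintro c s ⟨hs1, hs2, hs3⟩
    refine ⟨fun i j => ?_, fun i => ?_, fun i => ?_⟩
    · simp [hs1 i j]
    · simp [hs2 i]
    · simp [← Finset.mul_sum, hs3 i]

/-- The diagonals of the `n`-gon with vertices `0, 1, …, n - 1` in cyclic order. A diagonal is
represented by its pair of endpoints `(i, j)` with `i < j`; the endpoints are not adjacent. -/
def diagonals (n : ℕ) : Finset (Fin n × Fin n) :=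
  Finset.univ.filter fun d =>
    d.1.val + 2 ≤ d.2.val ∧ ¬ (d.1.val = 0 ∧ d.2.val + 1 = n)

/-- Two diagonals cross if their endpoints alternate around the polygon. -/
def Crosses {n : ℕ} (d e : Fin n × Fin n) : Prop :=
  (d.1 < e.1 ∧ e.1 < d.2 ∧ d.2 < e.2) ∨ (e.1 < d.1 ∧ d.1 < e.2 ∧ e.2 < d.2)

instance {n : ℕ} (d e : Fin n × Fin n) : Decidable (Crosses d e) := by
  unfold Crosses
  infer_instance

/-- A triangulation of the `n`-gon: a maximal set of pairwise non-crossing diagonals. -/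
def IsTriangulation {n : ℕ} (D : Finset (Fin n × Fin n)) : Prop :=
  (∀ d ∈ D, d ∈ diagonals n) ∧ (∀ d ∈ D, ∀ e ∈ D, ¬ Crosses d e) ∧
    ∀ d ∈ diagonals n, (∀ e ∈ D, ¬ Crosses d e) → d ∈ D

instance {n : ℕ} : DecidablePred (IsTriangulation (n := n)) := fun D => by
  have : Decidable (∀ d ∈ diagonals n, (∀ e ∈ D, ¬ Crosses d e) → d ∈ D) := inferInstance
  unfold IsTriangulation
  infer_instance

/-- The set of all triangulations of the `n`-gon. -/
def triangulations (n : ℕ) : Finset (Finset (Fin n × Fin n)) :=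
  (diagonals n).powerset.filter IsTriangulation

/-- The planar kinematic function `X_{ij} = ∑_{i ≤ a < b ≤ j - 1} s_{ab}`, for `d = (i, j)` with
`i < j`. -/
def planarX {n : ℕ} (s : kinematicSpace n) (d : Fin n × Fin n) : ℂ :=
  ∑ a : Fin n, ∑ b : Fin n, if d.1 ≤ a ∧ a < b ∧ b < d.2 then s.1 a b else 0

/-- The planar `φ³` amplitude: the sum over triangulations (equivalently, over the dual cubic
planar trees with `n` leaves) of the product of the propagators `1 / X_{ij}`. -/
def phi3Amplitude {n : ℕ} (s : kinematicSpace n) : ℂ :=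
  ∑ D ∈ triangulations n, ∏ d ∈ D, 1 / planarX s d

/-- The columns of the `2 × n` matrix
`(1 1 1 1 … 0; 0 1 1+x₁ 1+x₁+x₂ … 1)` that represents the point of the positive part
`(M_{0,n})_{>0}` with positive coordinates `x₁, …, x_{n-3}`. -/
def column {n : ℕ} (x : Fin (n - 3) → ℝ) (k : Fin n) : Fin 2 → ℝ :=
  if k.val + 1 = n then ![0, 1]
  else if k.val = 0 then ![1, 0]
  else ![1, 1 + ∑ m : Fin (n - 3), if m.val + 1 < k.val then x m else 0]

/-- The minor `(ij)` of that matrix. -/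
def minor {n : ℕ} (x : Fin (n - 3) → ℝ) (i j : Fin n) : ℝ :=
  Matrix.det !![column x i 0, column x j 0; column x i 1, column x j 1]

/-- The dihedral coordinate
`u_{ij} = [i, i+1 | j+1, j] = (i, j+1) (i+1, j) / ((i, j) (i+1, j+1))`, with indices read
cyclically. -/
def dihedralU {n : ℕ} (x : Fin (n - 3) → ℝ) (d : Fin n × Fin n) : ℝ :=
  (minor x d.1 (finRotate n d.2) * minor x (finRotate n d.1) d.2) /
    (minor x d.1 d.2 * minor x (finRotate n d.1) (finRotate n d.2))

/-- The Koba–Nielsen potential `φ_X = ∏ u_{ij}^{X_{ij}}`; on `(M_{0,n})_{>0}` the `u_{ij}` are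
positive reals and the powers are the principal ones. -/
def kobaNielsen {n : ℕ} (s : kinematicSpace n) (x : Fin (n - 3) → ℝ) : ℂ :=
  ∏ d ∈ diagonals n, (dihedralU x d : ℂ) ^ planarX s d

/-- `(M_{0,n})_{>0}` in the positive coordinates, which identify it with the open orthant. -/
def positivePart (n : ℕ) : Set (Fin (n - 3) → ℝ) := {x | ∀ i, 0 < x i}

/-- The density of `φ_X Ω` in the positive coordinates, where
`Ω = dx₁/x₁ ∧ ⋯ ∧ dx_{n-3}/x_{n-3}` is the Parke–Taylor form. -/
def stringIntegrand {n : ℕ} (s : kinematicSpace n) (x : Fin (n - 3) → ℝ) : ℂ :=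
  kobaNielsen s x * ∏ i, (x i : ℂ)⁻¹

/-- The integral `∫_{(M_{0,n})_{>0}} φ_X Ω`. -/
def stringIntegral {n : ℕ} (s : kinematicSpace n) : ℂ :=
  ∫ x in positivePart n, stringIntegrand s x

/-- The open chamber `Re X_{ij} > 0` of kinematic space, on which the integral converges. -/
def convergenceChamber (n : ℕ) : Set (kinematicSpace n) :=
  {s | ∀ d ∈ diagonals n, 0 < (planarX s d).re}

/-- Kinematic space with the hyperplanes `X_{ij} = 0, -1, -2, …` removed. -/
def regularSet (n : ℕ) : Set (kinematicSpace n) :=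
  {s | ∀ d ∈ diagonals n, ∀ k : ℕ, planarX s d ≠ -(k : ℂ)}

/-- `F` is the analytic continuation of the string integral: it is holomorphic on the (open,
connected, dense) set `regularSet n`, and it is given by the integral on the chamber of
convergence. Values of `F` outside `regularSet n` are irrelevant. -/
structure IsAnalyticContinuation {n : ℕ} (F : kinematicSpace n → ℂ) : Prop where
  holomorphic : DifferentiableOn ℂ F (regularSet n)
  eq_integral : ∀ s ∈ convergenceChamber n, F s = stringIntegral s

/-- The open string amplitude `I_n(s) = (α')^{n-3} ∫ φ_{α' X} Ω`, where the integral is understood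
through its analytic continuation `F`. -/
def openStringAmplitude {n : ℕ} (F : kinematicSpace n → ℂ) (α' : ℂ) (s : kinematicSpace n) : ℂ :=
  α' ^ (n - 3) * F (α' • s)

end

/-! Put m = n - 3 and x_i = exp t_i, and describe the finite points by their successive gaps y_1 =
1, y_2 = x_1, …, y_{m+1} = x_m. Diagonals then correspond to the proper subintervals (tubes) of [1,
m+1], each u_d is a cross-ratio of interval sums of gaps, and J_n becomes the integral J(X) over ℝ^m
of ∏ u_d^{X_d}. The exponents X_d may be treated as independent complex variables; kinematic space
enters only through a linear map at the end.

Convergence follows from 0 < u_d ≤ 1 and ∏ u_d ≤ exp(-|t_k|) for every k. For the continuation,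
scale the gaps inside a tube d: the logarithmic derivative of u_e is then δ_{de} plus a combination
of monomials in the u's, each divisible by u_d. Since the derivative of the integrand integrates to
zero, X_d J(X) is a combination of values J(X + a) with a_d ≥ 1 (`DihedralChart.mul_integral`), and
iterating this moves the domain to the left.

For the limit, insert 1 = ∏_d (u_d + ∏_{e crosses d} u_e) into the integrand and expand. Near the
origin the summand of a set S has at most simple poles, along X_d = 0 for those d in S that cross no
member of S (`exists_differentiableOn_mul_prod`). There are at most m such d, and m of them only if
S is a triangulation, so after multiplication by α'^m only triangulations survive.

The leading coefficient of a triangulation D is 1. It is computed on the ray where all X_d equal ε,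
with t = ε⁻¹ M τ, where the columns of M are the negated scaling directions of D. M is unimodular,
and as ε → 0 the integrand tends to exp(-∑ τ_j) on the positive orthant and to 0 almost everywhere
else (`tendsto_pow_mul_integral_tubeChart`). Finally, all continuations agree on the regular set by
the identity theorem (`eqOn_regularSet`). -/

/-! ### Convergence and functional equation of the integral in an abstract chart. -/

theorem integrable_exp_neg_mul_abs {c : ℝ} (hc : 0 < c) :
    Integrable fun x : ℝ => Real.exp (-c * |x|) := by
  rw [← integrableOn_univ, ← Iic_union_Ioi (a := (0 : ℝ))]
  refine IntegrableOn.union ?_ ?_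
  · refine (integrableOn_exp_mul_Iic hc 0).congr_fun (fun x hx => ?_) measurableSet_Iic
    simp [abs_of_nonpos (mem_Iic.1 hx)]
  · refine (integrableOn_exp_mul_Ioi (neg_neg_of_pos hc) 0).congr_fun (fun x hx => ?_)
      measurableSet_Ioi
    simp [abs_of_pos (mem_Ioi.1 hx)]

theorem exists_pos_lt_re {ι : Type*} [Finite ι] {X : ι → ℂ} (hX : ∀ d, 0 < (X d).re) :
    ∃ c > 0, ∀ d, c < (X d).re := by
  obtain h | h := isEmpty_or_nonempty ι
  · exact ⟨1, one_pos, fun d => h.elim d⟩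
  · obtain ⟨d₀, hd₀⟩ := Finite.exists_min fun d => (X d).re
    exact ⟨(X d₀).re / 2, by linarith [hX d₀], fun d => by linarith [hX d₀, hd₀ d]⟩

theorem isOpen_setOf_forall_lt_re {ι : Type*} [Finite ι] (c : ℝ) :
    IsOpen {X : ι → ℂ | ∀ d, c < (X d).re} := by
  simp only [ofPred_forall]
  exact isOpen_iInter_of_finite fun d =>
    isOpen_lt continuous_const (Complex.continuous_re.comp (continuous_apply d))

/-- Positive functions on `ℝ^m` that satisfy what is needed to continue the integral
`∫ ∏ d, u d t ^ X d` to complex exponents: decay, and derivatives that are combinations of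
monomials in the functions themselves. -/
structure DihedralChart (ι : Type*) [Fintype ι] [DecidableEq ι] (m : ℕ) where
  u : ι → (Fin m → ℝ) → ℝ
  pos : ∀ d t, 0 < u d t
  le_one : ∀ d t, u d t ≤ 1
  continuous_u : ∀ d, Continuous (u d)
  decay : ∀ t k, ∏ d, u d t ≤ Real.exp (-|t k|)
  dir : ι → Fin m → ℝ
  coeff : ι → ι → (ι → ℕ) →₀ ℝ
  -- Divisibility by `u d` is what makes the functional equation raise the exponent of `u d`, so
  -- that it can be iterated.
  one_le_of_mem_support : ∀ d e, ∀ a ∈ (coeff d e).support, 1 ≤ a d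
  hasLineDerivAt_u : ∀ d e t, HasLineDerivAt ℝ (u e)
    (u e t * ((if d = e then 1 else 0) + (coeff d e).sum fun a c => c * ∏ i, u i t ^ a i))
    t (dir d)

namespace DihedralChart

variable {ι : Type*} [Fintype ι] [DecidableEq ι] {m : ℕ} (C : DihedralChart ι m)

/-- The product `∏ d, u d t ^ X d`. -/
noncomputable def monomial (X : ι → ℂ) (t : Fin m → ℝ) : ℂ := ∏ d, (C.u d t : ℂ) ^ X d

/-- The integral of `∏ d, u d t ^ X d`. -/
noncomputable def integral (X : ι → ℂ) : ℂ := ∫ t, C.monomial X t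

theorem monomial_eq_exp (X : ι → ℂ) (t : Fin m → ℝ) :
    C.monomial X t = Complex.exp (∑ d, (Real.log (C.u d t) : ℂ) * X d) := by
  rw [Complex.exp_sum]
  refine Finset.prod_congr rfl fun d _ => ?_
  rw [Complex.cpow_def_of_ne_zero (by exact_mod_cast (C.pos d t).ne'),
    Complex.ofReal_log (C.pos d t).le]

theorem norm_monomial (X : ι → ℂ) (t : Fin m → ℝ) :
    ‖C.monomial X t‖ = ∏ d, C.u d t ^ (X d).re := by
  rw [monomial, norm_prod]
  exact Finset.prod_congr rfl fun d _ => Complex.norm_cpow_eq_rpow_re_of_pos (C.pos d t) _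

theorem monomial_add_natCast (X : ι → ℂ) (a : ι → ℕ) (t : Fin m → ℝ) :
    C.monomial (fun d => X d + a d) t = C.monomial X t * ∏ d, (C.u d t : ℂ) ^ a d := by
  rw [monomial, monomial, ← Finset.prod_mul_distrib]
  refine Finset.prod_congr rfl fun d _ => ?_
  rw [Complex.cpow_add _ _ (by exact_mod_cast (C.pos d t).ne'), Complex.cpow_natCast]

theorem continuous_log_u (d : ι) : Continuous fun t => Real.log (C.u d t) :=
  (C.continuous_u d).log fun t => (C.pos d t).ne'

theorem continuous_monomial (X : ι → ℂ) : Continuous (C.monomial X) := by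
  have h : C.monomial X = fun t => Complex.exp (∑ d, (Real.log (C.u d t) : ℂ) * X d) :=
    funext fun t => C.monomial_eq_exp X t
  rw [h]
  have := C.continuous_log_u
  fun_prop

/-- The m decay bounds, one per coordinate, are multiplied after splitting the exponent c into
pieces c/(m+1). The surplus piece is harmless because the product is at most 1, and the denominator
m + 1 also covers m = 0. -/
theorem prod_rpow_le {c : ℝ} (hc : 0 ≤ c) (t : Fin m → ℝ) :
    ∏ d, C.u d t ^ c ≤ ∏ k, Real.exp (-(c / (m + 1)) * |t k|) := by
  have hp : 0 < ∏ d, C.u d t := Finset.prod_pos fun d _ => C.pos d t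
  have h1 : ∏ d, C.u d t ≤ 1 := Finset.prod_le_one (fun d _ => (C.pos d t).le)
    fun d _ => C.le_one d t
  have hm : (0 : ℝ) < m + 1 := by positivity
  rw [Real.finsetProd_rpow _ _ fun d _ => (C.pos d t).le]
  calc (∏ d, C.u d t) ^ c ≤ (∏ d, C.u d t) ^ (c / (m + 1) * m) := by
        refine Real.rpow_le_rpow_of_exponent_ge hp h1 ?_
        rw [div_mul_eq_mul_div, div_le_iff₀ hm]
        nlinarith
    _ = ∏ _k : Fin m, (∏ d, C.u d t) ^ (c / (m + 1)) := by
        rw [Finset.prod_const, Finset.card_fin, Real.rpow_mul hp.le, Real.rpow_natCast]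
    _ ≤ ∏ k, Real.exp (-(c / (m + 1)) * |t k|) := by
        refine Finset.prod_le_prod (fun _ _ => (Real.rpow_pos_of_pos hp _).le) fun k _ => ?_
        calc (∏ d, C.u d t) ^ (c / (m + 1)) ≤ (Real.exp (-|t k|)) ^ (c / (m + 1)) :=
              Real.rpow_le_rpow hp.le (C.decay t k) (by positivity)
          _ = _ := by rw [← Real.exp_mul]; ring_nf

theorem integrable_prod_exp_neg_mul_abs {c : ℝ} (hc : 0 < c) :
    Integrable fun t : Fin m → ℝ => ∏ k, Real.exp (-c * |t k|) := by
  refine Integrable.fintype_prod (f := fun (_ : Fin m) (x : ℝ) => Real.exp (-c * |x|)) fun _ => ?_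
  exact integrable_exp_neg_mul_abs hc

theorem prod_rpow_le_prod_rpow {a b : ι → ℝ} (h : ∀ d, a d ≤ b d) (t : Fin m → ℝ) :
    ∏ d, C.u d t ^ b d ≤ ∏ d, C.u d t ^ a d :=
  Finset.prod_le_prod (fun d _ => (Real.rpow_pos_of_pos (C.pos d t) _).le)
    fun d _ => Real.rpow_le_rpow_of_exponent_ge (C.pos d t) (C.le_one d t) (h d)

theorem integrable_prod_rpow {c : ℝ} (hc : 0 < c) :
    Integrable fun t => ∏ d, C.u d t ^ c := by
  refine (integrable_prod_exp_neg_mul_abs (m := m) (c := c / (m + 1)) (by positivity)).mono'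
    (Continuous.aestronglyMeasurable ?_) (ae_of_all _ fun t => ?_)
  · exact continuous_finsetProd _ fun d _ =>
      (C.continuous_u d).rpow_const fun t => Or.inl (C.pos d t).ne'
  · rw [Real.norm_of_nonneg (Finset.prod_nonneg fun d _ => (Real.rpow_pos_of_pos (C.pos d t) _).le)]
    exact C.prod_rpow_le hc.le t

theorem integrable_monomial {X : ι → ℂ} (hX : ∀ d, 0 < (X d).re) :
    Integrable (C.monomial X) := by
  obtain ⟨c, hc, h⟩ := exists_pos_lt_re hX
  refine (C.integrable_prod_rpow hc).mono' (C.continuous_monomial X).aestronglyMeasurable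
    (ae_of_all _ fun t => ?_)
  rw [norm_monomial]
  exact C.prod_rpow_le_prod_rpow (fun d => (h d).le) t

/-- Logarithms appear when the integrand is differentiated in X; an arbitrarily small negative power
of the product absorbs them. -/
theorem abs_log_le {c : ℝ} (hc : 0 < c) (d : ι) (t : Fin m → ℝ) :
    |Real.log (C.u d t)| ≤ (∏ e, C.u e t ^ (-c)) / c := by
  rw [abs_of_nonpos (Real.log_nonpos (C.pos d t).le (C.le_one d t)), ← Real.log_inv]
  refine (Real.log_le_rpow_div (inv_nonneg.2 (C.pos d t).le) hc).trans ?_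
  gcongr
  rw [Real.inv_rpow (C.pos d t).le, ← Real.rpow_neg (C.pos d t).le]
  have h1 : ∀ e, 1 ≤ C.u e t ^ (-c) := fun e =>
    Real.one_le_rpow_of_pos_of_le_one_of_nonpos (C.pos e t) (C.le_one e t) (by linarith)
  calc C.u d t ^ (-c) = ∏ e, if e = d then C.u e t ^ (-c) else 1 := by simp
    _ ≤ _ := Finset.prod_le_prod (fun e _ => by split_ifs <;> linarith [h1 e])
      fun e _ => by split_ifs <;> linarith [h1 e]

theorem hasFDerivAt_monomial (X : ι → ℂ) (t : Fin m → ℝ) :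
    HasFDerivAt (fun X => C.monomial X t)
      (C.monomial X t • ∑ d, (Real.log (C.u d t) : ℂ) •
        ContinuousLinearMap.proj (R := ℂ) (φ := fun _ : ι => ℂ) d) X := by
  simp only [monomial_eq_exp]
  refine HasFDerivAt.cexp (HasFDerivAt.fun_sum fun d _ => ?_)
  exact (hasFDerivAt_apply d X).const_mul _

/-- Differentiation under the integral sign. If all real parts exceed c, half of the exponent c pays
for the logarithm and the other half keeps the bound integrable. -/
theorem differentiableOn_integral :
    DifferentiableOn ℂ C.integral {X : ι → ℂ | ∀ d, 0 < (X d).re} := by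
  intro X₀ hX₀
  obtain ⟨c, hc, h⟩ := exists_pos_lt_re hX₀
  have hs : {X : ι → ℂ | ∀ d, c < (X d).re} ∈ 𝓝 X₀ :=
    (isOpen_setOf_forall_lt_re c).mem_nhds h
  have hlog := C.continuous_log_u
  refine (hasFDerivAt_integral_of_dominated_of_fderiv_le (𝕜 := ℂ) (μ := volume)
    (F := fun X t => C.monomial X t)
    (F' := fun X t => C.monomial X t • ∑ d, (Real.log (C.u d t) : ℂ) •
        ContinuousLinearMap.proj (R := ℂ) (φ := fun _ : ι => ℂ) d)
    (bound := fun t => (∏ d, C.u d t ^ (c / 2)) * (Fintype.card ι * (c / 2)⁻¹)) hs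
    (Eventually.of_forall fun X => (C.continuous_monomial X).aestronglyMeasurable)
    (C.integrable_monomial hX₀) ?_ ?_ ?_ ?_).differentiableAt.differentiableWithinAt
  · refine Continuous.aestronglyMeasurable ?_
    have := C.continuous_monomial X₀
    fun_prop
  · refine ae_of_all _ fun t X hX => ?_
    have hpos : ∀ a : ℝ, 0 ≤ ∏ d, C.u d t ^ a := fun a =>
      Finset.prod_nonneg fun d _ => (Real.rpow_pos_of_pos (C.pos d t) _).le
    rw [norm_smul, norm_monomial]
    have h1 : ∏ d, C.u d t ^ (X d).re ≤ ∏ d, C.u d t ^ c :=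
      C.prod_rpow_le_prod_rpow (fun d => (hX d).le) t
    have h2 : ‖∑ d, (Real.log (C.u d t) : ℂ) •
        ContinuousLinearMap.proj (R := ℂ) (φ := fun _ : ι => ℂ) d‖ ≤
        Fintype.card ι * ((∏ e, C.u e t ^ (-(c / 2))) / (c / 2)) := by
      refine (norm_sum_le _ _).trans ?_
      rw [← nsmul_eq_mul, ← Finset.card_univ, ← Finset.sum_const]
      refine Finset.sum_le_sum fun d _ => ?_
      have h3 : ‖ContinuousLinearMap.proj (R := ℂ) (φ := fun _ : ι => ℂ) d‖ ≤ 1 :=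
        ContinuousLinearMap.opNorm_le_bound _ zero_le_one fun x => by
          simpa using norm_le_pi_norm x d
      rw [norm_smul, Complex.norm_real, Real.norm_eq_abs]
      exact (mul_le_of_le_one_right (abs_nonneg _) h3).trans (C.abs_log_le (by linarith) d t)
    refine (mul_le_mul h1 h2 (norm_nonneg _) (hpos _)).trans (le_of_eq ?_)
    have h4 : (∏ d, C.u d t ^ c) * ∏ e, C.u e t ^ (-(c / 2)) = ∏ d, C.u d t ^ (c / 2) := by
      rw [← Finset.prod_mul_distrib]
      refine Finset.prod_congr rfl fun d _ => ?_
      rw [← Real.rpow_add (C.pos d t)]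
      ring_nf
    rw [← h4]
    ring
  · exact (C.integrable_prod_rpow (by linarith)).mul_const _
  · exact ae_of_all _ fun t X _ => C.hasFDerivAt_monomial X t

/-- The logarithmic derivative of the monomial is the sum of X_e times that of u_e; multiplying by a
monomial in the u's merely shifts the exponents. -/
theorem hasLineDerivAt_monomial (X : ι → ℂ) (d : ι) (t : Fin m → ℝ) :
    HasLineDerivAt ℝ (C.monomial X)
      (X d * C.monomial X t + ∑ e, X e * (C.coeff d e).sum fun a c =>
        (c : ℂ) * C.monomial (fun i => X i + a i) t) t (C.dir d) := by
  have h : ∀ e, HasDerivAt (fun s : ℝ => (Real.log (C.u e (t + s • C.dir d)) : ℂ))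
      (((if d = e then 1 else 0) + (C.coeff d e).sum fun a c => c * ∏ i, C.u i t ^ a i : ℝ) : ℂ)
      0 := fun e => by
    have h0 : HasDerivAt _ _ (0 : ℝ) := C.hasLineDerivAt_u d e t
    have h1 := h0.log (by simpa using (C.pos e t).ne')
    simp only [zero_smul, add_zero] at h1
    rw [mul_div_cancel_left₀ _ (C.pos e t).ne'] at h1
    exact h1.ofReal_comp
  unfold HasLineDerivAt
  simp only [monomial_eq_exp _ _ (_ + _)]
  refine (HasDerivAt.cexp (HasDerivAt.fun_sum fun e _ => (h e).mul_const (X e))).congr_deriv ?_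
  simp only [zero_smul, add_zero, ← monomial_eq_exp, monomial_add_natCast]
  push_cast
  simp only [add_mul, Finset.sum_add_distrib, mul_add, Finset.mul_sum]
  congr 1
  · rw [Finset.sum_eq_single d (fun e _ he => by simp [Ne.symm he]) (by simp)]
    simp [mul_comm]
  · refine Finset.sum_congr rfl fun e _ => ?_
    simp only [Finsupp.sum, Finset.mul_sum, Finset.sum_mul, Complex.ofReal_sum]
    refine Finset.sum_congr rfl fun a _ => ?_
    push_cast
    ring

/-- The functional equation obtained by integrating the derivative of the integrand. -/
theorem mul_integral {X : ι → ℂ} (hX : ∀ d, 0 < (X d).re) (d : ι) :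
    X d * C.integral X = -∑ e, X e * (C.coeff d e).sum fun a c =>
      (c : ℂ) * C.integral (fun i => X i + a i) := by
  have hX' : ∀ a : ι → ℕ, ∀ i, 0 < (X i + a i).re := fun a i => by
    have := hX i
    simp
    positivity
  have hi : ∀ e, Integrable fun t => X e * (C.coeff d e).sum fun a c =>
        (c : ℂ) * C.monomial (fun i => X i + a i) t := fun e =>
    (integrable_finsetSum _ fun a _ => (C.integrable_monomial (hX' a)).const_mul _).const_mul _
  have hs : Integrable fun t => ∑ e, X e * (C.coeff d e).sum fun a c =>
        (c : ℂ) * C.monomial (fun i => X i + a i) t := integrable_finsetSum _ fun e _ => hi e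
  -- Integration by parts against the constant 1: the integral of the line derivative vanishes.
  have h1 := integral_bilinear_hasLineDerivAt_right_eq_neg_left_of_integrable
    (μ := (volume : Measure (Fin m → ℝ))) (f := fun _ => (1 : ℂ)) (f' := fun _ => 0)
    (g := C.monomial X)
    (g' := fun t => X d * C.monomial X t + ∑ e, X e * (C.coeff d e).sum fun a c =>
        (c : ℂ) * C.monomial (fun i => X i + a i) t) (v := C.dir d)
    (B := ContinuousLinearMap.mul ℝ ℂ)
    (by simp)
    (by simpa using! ((C.integrable_monomial hX).const_mul _).add hs)
    (by simpa using C.integrable_monomial hX)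
    (fun t _ => hasDerivAt_const _ _) (fun t _ => C.hasLineDerivAt_monomial X d t)
  simp only [ContinuousLinearMap.mul_apply', one_mul, zero_mul, integral_zero, neg_zero] at h1
  rw [integral_add ((C.integrable_monomial hX).const_mul _) hs, integral_const_mul,
    integral_finsetSum _ fun e _ => hi e] at h1
  rw [eq_neg_iff_add_eq_zero, ← h1, integral]
  congr 1
  refine Finset.sum_congr rfl fun e _ => ?_
  rw [integral_const_mul]
  congr 1
  simp only [Finsupp.sum]
  rw [integral_finsetSum _ fun a _ => (C.integrable_monomial (hX' a)).const_mul _]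
  exact Finset.sum_congr rfl fun a _ => (integral_const_mul _ _).symm

end DihedralChart

/-! ### Identity theorem in the complement of the hyperplanes, and maximal compatible sets. -/

theorem isClosed_range_neg_natCast : IsClosed (range fun k : ℕ => -(k : ℂ)) := by
  have h : range (fun k : ℕ => -(k : ℂ)) =
      {z : ℂ | z.im = 0} ∩ {z : ℂ | -z.re ∈ range ((↑) : ℕ → ℝ)} := by
    ext z
    simp only [mem_range, mem_inter_iff, mem_ofPred_eq]
    constructor
    · rintro ⟨k, rfl⟩
      simp
    · rintro ⟨h1, k, hk⟩
      exact ⟨k, by apply Complex.ext <;> simp [h1, hk]⟩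
  rw [h]
  exact (isClosed_eq Complex.continuous_im continuous_const).inter
    (Nat.isClosedEmbedding_coe_real.isClosed_range.preimage Complex.continuous_re.neg)

theorem isOpen_setOf_forall_ne_neg_natCast {E ι : Type*} [TopologicalSpace E] [Finite ι]
    {l : ι → E → ℂ} (hl : ∀ d, Continuous (l d)) :
    IsOpen {s : E | ∀ d, ∀ k : ℕ, l d s ≠ -(k : ℂ)} := by
  have h : {s : E | ∀ d, ∀ k : ℕ, l d s ≠ -(k : ℂ)} =
      ⋂ d, l d ⁻¹' (range fun k : ℕ => -(k : ℂ))ᶜ := by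
    ext s
    simp [eq_comm]
  rw [h]
  exact isOpen_iInter_of_finite fun d => isClosed_range_neg_natCast.isOpen_compl.preimage (hl d)

/-- Only countably many y are bad. For fixed d and k the real part of the equation determines r,
since c_d = -k is impossible. The imaginary part then determines y unless r = 1, and r = 1 is
excluded by the assumption on w. -/
theorem exists_forall_segment_ne_neg_natCast {ι : Type*} [Countable ι] {c : ι → ℝ} {w : ι → ℂ}
    (hc : ∀ d, 0 < c d) (hw : ∀ d, ∀ k : ℕ, w d ≠ -(k : ℂ)) :
    ∃ y : ℝ, ∀ d, ∀ k : ℕ, ∀ r : ℝ,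
      (1 - r : ℂ) * (c d * (1 + y * Complex.I)) + r * w d ≠ -(k : ℂ) := by
  let B : Set ℝ := ⋃ d, ⋃ k : ℕ,
    {y | ∃ r : ℝ, (1 - r : ℂ) * (c d * (1 + y * Complex.I)) + r * w d = -(k : ℂ)}
  have hB : B.Countable := by
    refine countable_iUnion fun d => countable_iUnion fun k => Set.Subsingleton.countable ?_
    rintro y ⟨r, hr⟩ y' ⟨r', hr'⟩
    have e1 := congrArg Complex.re hr
    have e2 := congrArg Complex.im hr
    have e3 := congrArg Complex.re hr'
    have e4 := congrArg Complex.im hr'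
    simp at e1 e2 e3 e4
    have hσ : (w d).re - c d ≠ 0 := fun h => by
      have : c d = -k := by rw [← e1]; linear_combination (-r) * h
      have := hc d
      have : (0 : ℝ) ≤ k := k.cast_nonneg
      linarith
    have hrr : r = r' := by
      have : (r - r') * ((w d).re - c d) = 0 := by linear_combination e1 - e3
      rcases mul_eq_zero.1 this with h | h
      · linarith
      · exact absurd h hσ
    subst hrr
    by_cases hr1 : r = 1
    · subst hr1
      exact absurd (by simpa using hr) (hw d k)
    · have : ((1 - r) * c d) * (y - y') = 0 := by linear_combination e2 - e4
      rcases mul_eq_zero.1 this with h | h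
      · rcases mul_eq_zero.1 h with h | h
        · exact absurd (by linarith) hr1
        · exact absurd h (hc d).ne'
      · linarith
  obtain ⟨y, hy⟩ := (hB.dense_compl ℝ).nonempty
  refine ⟨y, fun d k r h => hy ?_⟩
  exact mem_iUnion.2 ⟨d, mem_iUnion.2 ⟨k, r, h⟩⟩

/-- Holomorphic functions on a convex open set from which the hyperplanes `l d s = -k` are
removed agree if they agree on the chamber `0 < Re (l d s)`. -/
theorem eqOn_of_eqOn_chamber {E ι : Type*} [NormedAddCommGroup E] [NormedSpace ℂ E] [Finite ι]
    (l : ι → E →L[ℂ] ℂ) {W : Set E} (hWo : IsOpen W) (hWc : Convex ℝ W)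
    (hW : ∀ s, (∀ d, 0 < (l d s).re) → s ∈ W) {c : ι → ℝ} (hc : ∀ d, 0 < c d) {t₀ : E}
    (ht₀ : ∀ d, l d t₀ = c d) {f g : E → ℂ}
    (hf : DifferentiableOn ℂ f (W ∩ {s | ∀ d, ∀ k : ℕ, l d s ≠ -(k : ℂ)}))
    (hg : DifferentiableOn ℂ g (W ∩ {s | ∀ d, ∀ k : ℕ, l d s ≠ -(k : ℂ)}))
    (hfg : ∀ s, (∀ d, 0 < (l d s).re) → f s = g s) :
    EqOn f g (W ∩ {s | ∀ d, ∀ k : ℕ, l d s ≠ -(k : ℂ)}) := by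
  rintro s ⟨hsW, hs⟩
  -- A complex multiple of `t₀` still lies in the chamber and is joined to `s` by a segment avoiding
  -- all hyperplanes; the one-variable identity theorem applies on the complex line through it.
  obtain ⟨y, hy⟩ := exists_forall_segment_ne_neg_natCast hc hs
  set t : E := (1 + y * Complex.I) • t₀ with ht
  have hlt : ∀ d, l d t = c d * (1 + y * Complex.I) := fun d => by
    rw [ht, map_smul, ht₀, smul_eq_mul, mul_comm]
  have htc : ∀ d, 0 < (l d t).re := fun d => by simpa [hlt] using hc d
  set V := W ∩ {s | ∀ d, ∀ k : ℕ, l d s ≠ -(k : ℂ)} with hV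
  have hVo : IsOpen V :=
    hWo.inter (isOpen_setOf_forall_ne_neg_natCast fun d => (l d).continuous)
  let γ : ℂ → E := fun z => t + z • (s - t)
  have hγ : Differentiable ℂ γ := by fun_prop
  have hU : Complex.ofReal '' Icc (0 : ℝ) 1 ⊆ γ ⁻¹' V := by
    rintro _ ⟨r, hr, rfl⟩
    have hγr : γ r = (1 - r) • t + r • s := by
      simp only [γ]
      module
    refine ⟨?_, fun d k => ?_⟩
    · rw [hγr]
      exact hWc (hW t htc) hsW (by linarith [hr.2]) hr.1 (by ring)
    · have : l d (γ r) = (1 - r : ℂ) * (c d * (1 + y * Complex.I)) + r * l d s := by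
        simp only [γ, map_add, map_smul, map_sub, smul_eq_mul, hlt]
        ring
      rw [this]
      exact hy d k r
  have han : ∀ h : E → ℂ, DifferentiableOn ℂ h V →
      AnalyticOnNhd ℂ (h ∘ γ) (Complex.ofReal '' Icc (0 : ℝ) 1) := fun h hh =>
    ((hh.comp hγ.differentiableOn (mapsTo_preimage γ V)).analyticOnNhd
      (hVo.preimage hγ.continuous)).mono hU
  have hopen : IsOpen {s : E | ∀ d, 0 < (l d s).re} := by
    simp only [ofPred_forall]
    exact isOpen_iInter_of_finite fun d =>
      isOpen_lt continuous_const (Complex.continuous_re.comp (l d).continuous)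
  have hev : f ∘ γ =ᶠ[𝓝 0] g ∘ γ := by
    have : γ ⁻¹' {s : E | ∀ d, 0 < (l d s).re} ∈ 𝓝 0 :=
      (hopen.preimage hγ.continuous).mem_nhds (by simpa [γ] using htc)
    filter_upwards [this] with z hz using hfg _ hz
  have := (han f hf).eqOn_of_preconnected_of_eventuallyEq (han g hg)
    ((convex_Icc (0 : ℝ) 1).isPreconnected.image _ Complex.continuous_ofReal.continuousOn)
    (mem_image_of_mem _ (left_mem_Icc.2 zero_le_one)) (by simpa using hev)
    (mem_image_of_mem _ (right_mem_Icc.2 zero_le_one))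
  simpa [γ] using this

theorem re_add_natCast_pos {ι : Type*} {X : ι → ℂ} (hX : ∀ d, 0 < (X d).re) (a : ι → ℕ) (d : ι) :
    0 < (X d + a d).re := by
  have := hX d
  simp
  positivity

theorem eqOn_of_eq_of_re_pos {ι : Type*} [Fintype ι] {W : Set (ι → ℂ)} (hWo : IsOpen W) (hWc : Convex ℝ W)
    (hW : ∀ X : ι → ℂ, (∀ d, 0 < (X d).re) → X ∈ W) {f g : (ι → ℂ) → ℂ}
    (hf : DifferentiableOn ℂ f (W ∩ {X | ∀ d, ∀ k : ℕ, X d ≠ -(k : ℂ)}))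
    (hg : DifferentiableOn ℂ g (W ∩ {X | ∀ d, ∀ k : ℕ, X d ≠ -(k : ℂ)}))
    (hfg : ∀ X : ι → ℂ, (∀ d, 0 < (X d).re) → f X = g X) :
    EqOn f g (W ∩ {X | ∀ d, ∀ k : ℕ, X d ≠ -(k : ℂ)}) :=
  eqOn_of_eqOn_chamber (fun d => ContinuousLinearMap.proj (R := ℂ) (φ := fun _ : ι => ℂ) d)
    hWo hWc hW (c := fun _ => 1) (t₀ := fun _ => 1) (fun _ => one_pos) (fun _ => by simp) hf hg hfg

theorem isOpen_setOf_forall_neg_lt_re {ι : Type*} [Finite ι] (κ : ι → ℝ) :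
    IsOpen {X : ι → ℂ | ∀ d, -κ d < (X d).re} := by
  simp only [ofPred_forall]
  exact isOpen_iInter_of_finite fun d =>
    isOpen_lt continuous_const (Complex.continuous_re.comp (continuous_apply d))

theorem convex_setOf_forall_neg_lt_re {ι : Type*} (κ : ι → ℝ) :
    Convex ℝ {X : ι → ℂ | ∀ d, -κ d < (X d).re} := by
  intro X hX Y hY a b ha hb hab d
  have h1 := hX d
  have h2 := hY d
  simp only [Pi.add_apply, Pi.smul_apply, Complex.add_re, Complex.real_smul, Complex.mul_re,
    Complex.ofReal_re, Complex.ofReal_im, zero_mul, sub_zero]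
  obtain rfl : b = 1 - a := by linarith
  rcases eq_or_lt_of_le ha with rfl | ha
  · linarith
  · nlinarith [mul_pos ha (neg_lt_iff_pos_add.1 h1), mul_nonneg hb (neg_lt_iff_pos_add.1 h2).le]

theorem differentiable_prod_apply {ι : Type*} [Fintype ι] (s : Finset ι) :
    Differentiable ℂ fun X : ι → ℂ => ∏ i ∈ s, X i := by
  classical
  induction s using Finset.induction_on with
  | empty => simp
  | insert i s hi ih =>
    simp only [Finset.prod_insert hi]
    exact Differentiable.mul (by fun_prop) ih

/-- Maximal sets of pairwise compatible elements, where `R d e` means that `d` and `e` are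
incompatible. -/
def IsMaximalCompatible {ι : Type*} (R : ι → ι → Prop) (D : Finset ι) : Prop :=
  (∀ d ∈ D, ∀ e ∈ D, ¬ R d e) ∧ ∀ d, (∀ e ∈ D, ¬ R d e) → d ∈ D

theorem exists_isMaximalCompatible_of_compatible {ι : Type*} [Fintype ι] {R : ι → ι → Prop}
    (hsymm : ∀ d e, R d e → R e d) (hirr : ∀ d, ¬ R d d) {N : Finset ι}
    (hN : ∀ d ∈ N, ∀ e ∈ N, ¬ R d e) : ∃ D, N ⊆ D ∧ IsMaximalCompatible R D := by
  classical
  obtain ⟨D, hD, hmax⟩ := Finset.exists_max_image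
    (Finset.univ.filter fun D : Finset ι => N ⊆ D ∧ ∀ d ∈ D, ∀ e ∈ D, ¬ R d e) Finset.card
    ⟨N, by simpa using hN⟩
  simp only [Finset.mem_filter_univ] at hD hmax
  refine ⟨D, hD.1, hD.2, fun d hd => ?_⟩
  by_contra hdD
  have := hmax (insert d D) ⟨hD.1.trans (Finset.subset_insert _ _), ?_⟩
  · rw [Finset.card_insert_of_notMem hdD] at this
    omega
  · intro a ha b hb
    rcases Finset.mem_insert.1 ha with rfl | ha' <;> rcases Finset.mem_insert.1 hb with rfl | hb'
    · exact hirr _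
    · exact hd b hb'
    · exact fun h => hd a ha' (hsymm _ _ h)
    · exact hD.2 a ha' b hb'

/-! ### Continuation of the integral and its poles at the origin. -/

namespace DihedralChart

variable {ι : Type*} [Fintype ι] [DecidableEq ι] {m : ℕ} (C : DihedralChart ι m)

/-- Induction on the total width ∑ κ_d. To widen the domain by one in direction d, divide the
functional equation for d by X_d: every shift on its right side has a_d ≥ 1 and lands in the smaller
domain already treated. -/
theorem exists_continuation_of_sum_eq (N : ℕ) : ∀ κ : ι → ℕ, ∑ d, κ d = N →
    ∃ G : (ι → ℂ) → ℂ,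
      DifferentiableOn ℂ G ({X | ∀ d, -(κ d : ℝ) < (X d).re} ∩
        {X | ∀ d, ∀ k : ℕ, X d ≠ -(k : ℂ)}) ∧
      ∀ X : ι → ℂ, (∀ d, 0 < (X d).re) → G X = C.integral X := by
  induction N with
  | zero =>
    intro κ hκ
    have hκ0 : ∀ d, κ d = 0 := by simpa using hκ
    refine ⟨C.integral, C.differentiableOn_integral.mono ?_, fun _ _ => rfl⟩
    rintro X ⟨hX, -⟩ d
    simpa [hκ0] using hX d
  | succ N ih =>
    intro κ hκ
    obtain ⟨d, hd⟩ : ∃ d, κ d ≠ 0 := by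
      by_contra! h
      simp [h] at hκ
    obtain ⟨G, hG, hGJ⟩ := ih (Function.update κ d (κ d - 1)) (by
      rw [Finset.sum_update_of_mem (Finset.mem_univ d)]
      rw [← Finset.add_sum_erase _ _ (Finset.mem_univ d), Finset.erase_eq] at hκ
      omega)
    refine ⟨fun X => -(X d)⁻¹ * ∑ e, X e * (C.coeff d e).sum fun a c =>
      (c : ℂ) * G (fun i => X i + a i), ?_, fun X hX => ?_⟩
    · refine DifferentiableOn.mul (DifferentiableOn.neg (DifferentiableOn.inv (by fun_prop)
        fun X hX => by simpa using hX.2 d 0)) (DifferentiableOn.fun_sum fun e _ => ?_)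
      refine DifferentiableOn.mul (by fun_prop) ?_
      simp only [Finsupp.sum]
      refine DifferentiableOn.fun_sum fun a ha => DifferentiableOn.const_mul ?_ _
      refine hG.comp (f := fun X : ι → ℂ => fun i => X i + (a i : ℂ)) (by fun_prop)
        fun X hX => ⟨fun e => ?_, fun e k h => hX.2 e (k + a e) ?_⟩
      · have h1 := hX.1 e
        simp only [Complex.add_re, Complex.natCast_re]
        by_cases hed : e = d
        · subst hed
          have h2 : (1 : ℝ) ≤ a e := by exact_mod_cast C.one_le_of_mem_support _ _ a ha
          rw [Function.update_self, Nat.cast_sub (by omega)]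
          push_cast
          linarith
        · rw [Function.update_of_ne hed]
          have : (0 : ℝ) ≤ a e := Nat.cast_nonneg _
          linarith
      · push_cast
        linear_combination h
    · have hXd : X d ≠ 0 := fun h => by simpa [h] using hX d
      have h1 : ∀ a : ι → ℕ, G (fun i => X i + a i) = C.integral fun i => X i + a i := fun a =>
        hGJ _ (re_add_natCast_pos hX a)
      simp only [h1]
      rw [neg_mul, ← mul_neg, ← C.mul_integral hX d, inv_mul_cancel_left₀ hXd]

/-- The integral continues holomorphically to all exponents outside the hyperplanes
`X d = -k`. -/
theorem exists_continuation : ∃ G : (ι → ℂ) → ℂ,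
    DifferentiableOn ℂ G {X | ∀ d, ∀ k : ℕ, X d ≠ -(k : ℂ)} ∧
    ∀ X : ι → ℂ, (∀ d, 0 < (X d).re) → G X = C.integral X := by
  choose G hG hGJ using fun K : ℕ => C.exists_continuation_of_sum_eq _ (fun _ => K) rfl
  have hmono : ∀ K L : ℕ, K ≤ L → ∀ X : ι → ℂ, (∀ d, -(K : ℝ) < (X d).re) →
      (∀ d, ∀ k : ℕ, X d ≠ -(k : ℂ)) → G K X = G L X := fun K L hKL X hX hX' => by
    refine eqOn_of_eq_of_re_pos (isOpen_setOf_forall_neg_lt_re fun _ => (K : ℝ))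
      (convex_setOf_forall_neg_lt_re _) (fun X hX d => ?_) (hG K) ((hG L).mono ?_)
      (fun X hX => by rw [hGJ K X hX, hGJ L X hX]) ⟨hX, hX'⟩
    · have : (0 : ℝ) ≤ K := K.cast_nonneg
      linarith [hX d]
    · refine inter_subset_inter_left _ fun X hX d => ?_
      have : (K : ℝ) ≤ L := by exact_mod_cast hKL
      linarith [hX d]
  have hK : ∀ X : ι → ℂ, ∀ d, -((⌈‖X‖⌉₊ + 1 : ℕ) : ℝ) < (X d).re := fun X d => by
    have h1 := Nat.le_ceil ‖X‖
    have h2 := norm_le_pi_norm X d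
    have h3 := neg_le_of_abs_le (Complex.abs_re_le_norm (X d))
    push_cast
    linarith
  refine ⟨fun X => G (⌈‖X‖⌉₊ + 1) X, fun X hX => ?_, fun X hX => hGJ _ X hX⟩
  have hopen := isOpen_setOf_forall_ne_neg_natCast (l := fun (d : ι) (X : ι → ℂ) => X d)
    fun d => continuous_apply d
  -- The index depends on the point, but for Y near X it is at most `⌈‖X‖⌉₊ + 2`, so the glued
  -- function coincides locally with one holomorphic piece.
  have hev : ∀ᶠ Y in 𝓝 X, G (⌈‖Y‖⌉₊ + 1) Y = G (⌈‖X‖⌉₊ + 1 + 1) Y := by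
    have h1 : ∀ᶠ Y in 𝓝 X, ‖Y‖ < ‖X‖ + 1 :=
      continuous_norm.continuousAt.eventually_lt continuousAt_const (by simp)
    filter_upwards [h1, hopen.mem_nhds hX] with Y hY hY'
    refine hmono _ _ ?_ Y (hK Y) hY'
    rw [add_le_add_iff_right, ← Nat.ceil_add_one (norm_nonneg _)]
    exact Nat.ceil_le_ceil hY.le
  have hd : DifferentiableAt ℂ (G (⌈‖X‖⌉₊ + 1 + 1)) X := by
    refine (hG _).differentiableAt ((IsOpen.inter
      (isOpen_setOf_forall_neg_lt_re fun _ => ((⌈‖X‖⌉₊ + 1 + 1 : ℕ) : ℝ)) hopen).mem_nhds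
      ⟨fun d => ?_, hX⟩)
    have := hK X d
    push_cast at this ⊢
    linarith
  exact (hd.congr_of_eventuallyEq hev).differentiableWithinAt

/-- Near the origin, the poles of the shifted integral are at most simple poles along the
hyperplanes `X d = 0` of the unshifted exponents. -/
theorem exists_differentiableOn_mul_prod (N : ℕ) : ∀ a : ι → ℕ,
    (Finset.univ.filter fun d => a d = 0).card = N →
    ∃ H : (ι → ℂ) → ℂ, DifferentiableOn ℂ H {X | ∀ d, -1 < (X d).re} ∧
      ∀ X : ι → ℂ, (∀ d, 0 < (X d).re) →
        H X = C.integral (fun i => X i + a i) * ∏ d with a d = 0, X d := by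
  induction N using Nat.strong_induction_on with
  | _ N ih =>
    intro a ha
    by_cases h0 : ∃ d, a d = 0
    · obtain ⟨d, hd⟩ := h0
      -- A shift produced by the functional equation for d removes d from the vanishing exponents
      -- and adds none, so the induction hypothesis applies to a + b.
      have hsub : ∀ b : ι → ℕ, 1 ≤ b d → (Finset.univ.filter fun i => (a + b) i = 0) ⊆
          (Finset.univ.filter fun i => a i = 0).erase d := fun b hb i hi => by
        simp only [Finset.mem_filter_univ, Pi.add_apply, Finset.mem_erase] at hi ⊢
        refine ⟨fun h => ?_, by omega⟩
        subst h
        omega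
      have hmem : d ∈ Finset.univ.filter fun i => a i = 0 := by simpa using hd
      have key : ∀ b : ι → ℕ, ∃ H : (ι → ℂ) → ℂ, 1 ≤ b d →
          DifferentiableOn ℂ H {X | ∀ d, -1 < (X d).re} ∧
          ∀ X : ι → ℂ, (∀ d, 0 < (X d).re) →
            H X = C.integral (fun i => X i + (a + b) i) * ∏ d with (a + b) d = 0, X d := fun b => by
        by_cases hb : 1 ≤ b d
        · obtain ⟨H, hH⟩ := ih _ (by
            rw [← ha]
            exact (Finset.card_le_card (hsub b hb)).trans_lt
              (Finset.card_erase_lt_of_mem hmem)) (a + b) rfl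
          exact ⟨H, fun _ => hH⟩
        · exact ⟨0, fun h => absurd h hb⟩
      choose H hH using key
      -- The extra product supplies those factors X_i that the smaller denominator of the shifted
      -- term does not need.
      refine ⟨fun X => -∑ e, (X e + a e) * (C.coeff d e).sum fun b c => (c : ℂ) * (H b X *
        ∏ i ∈ ((Finset.univ.filter fun i => a i = 0).erase d) \
          (Finset.univ.filter fun i => (a + b) i = 0), X i), ?_, fun X hX => ?_⟩
      · refine DifferentiableOn.neg (DifferentiableOn.fun_sum fun e _ => ?_)
        refine DifferentiableOn.mul (by fun_prop) ?_
        simp only [Finsupp.sum]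
        refine DifferentiableOn.fun_sum fun b hb => DifferentiableOn.const_mul ?_ _
        exact (hH b (C.one_le_of_mem_support _ _ b hb)).1.mul
          (differentiable_prod_apply _).differentiableOn
      · rw [← Finset.mul_prod_erase _ _ hmem, ← mul_assoc, mul_comm _ (X d)]
        have h1 := C.mul_integral (fun i => re_add_natCast_pos hX a i) d
        simp only [hd, Nat.cast_zero, add_zero] at h1
        rw [h1, neg_mul, Finset.sum_mul, neg_inj]
        refine Finset.sum_congr rfl fun e _ => ?_
        rw [mul_assoc]
        congr 1
        simp only [Finsupp.sum]
        rw [Finset.sum_mul]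
        refine Finset.sum_congr rfl fun b hb => ?_
        have hb' := C.one_le_of_mem_support _ _ b hb
        rw [(hH b hb').2 X hX, mul_assoc, mul_assoc]
        rw [mul_comm (∏ d with (a + b) d = 0, X d), Finset.prod_sdiff (hsub b hb')]
        simp only [Pi.add_apply, Nat.cast_add, add_assoc]
    · push Not at h0
      -- With every exponent raised by at least 1, the integral itself converges for Re X_d > -1.
      refine ⟨fun X => C.integral fun i => X i + a i, ?_, fun X _ => by simp [h0]⟩
      refine C.differentiableOn_integral.comp (f := fun X : ι → ℂ => fun i => X i + (a i : ℂ))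
        (by fun_prop) fun X hX d => ?_
      have h1 : (1 : ℝ) ≤ a d := by exact_mod_cast Nat.one_le_iff_ne_zero.2 (h0 d)
      have := hX d
      simp only [Complex.add_re, Complex.natCast_re]
      linarith

/-! ### Expansion by the u-equations and the leading term at the origin. -/

variable {ι : Type*} [Fintype ι] [DecidableEq ι] {m : ℕ} (C : DihedralChart ι m)
  (R : ι → ι → Prop) [DecidableRel R]

/-- The exponents of the summand belonging to `S` in the expansion of
`∏ d, (u d + ∏ e with R d e, u e)`. -/
def expansionExponent (S : Finset ι) (d : ι) : ℕ :=
  (if d ∈ S then 0 else 1) + (S.filter fun e => R e d).card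

variable {R}

/-- Each factor of ∏_d (u_d + ∏_{e crosses d} u_e) equals 1; S records the factors from which the
second term is chosen. -/
theorem sum_prod_pow_expansionExponent
    (hu : ∀ d t, C.u d t + ∏ e with R d e, C.u e t = 1) (t : Fin m → ℝ) :
    ∑ S : Finset ι, ∏ d, C.u d t ^ expansionExponent R S d = 1 := by
  have h1 : ∏ d, ((∏ e with R d e, C.u e t) + C.u d t) = 1 :=
    Finset.prod_eq_one fun d _ => by rw [add_comm, hu]
  rw [← h1, Finset.prod_add, Finset.powerset_univ]
  refine Finset.sum_congr rfl fun S _ => ?_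
  simp only [expansionExponent, pow_add, Finset.prod_mul_distrib]
  rw [mul_comm]
  congr 1
  · simp only [Finset.prod_filter]
    rw [Finset.prod_comm]
    refine Finset.prod_congr rfl fun d _ => ?_
    rw [← Finset.prod_filter, Finset.prod_const]
  · simp only [pow_ite, pow_zero, pow_one]
    rw [Finset.prod_ite]
    simp [Finset.filter_not]

theorem integral_eq_sum_expansionExponent
    (hu : ∀ d t, C.u d t + ∏ e with R d e, C.u e t = 1) {X : ι → ℂ} (hX : ∀ d, 0 < (X d).re) :
    C.integral X = ∑ S : Finset ι, C.integral fun d => X d + expansionExponent R S d := by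
  simp only [integral]
  rw [← integral_finsetSum _ fun S _ => C.integrable_monomial (re_add_natCast_pos hX _)]
  refine integral_congr_ae (ae_of_all _ fun t => ?_)
  have h := congrArg (Complex.ofReal) (C.sum_prod_pow_expansionExponent hu t)
  push_cast at h
  simp only [monomial_add_natCast, ← Finset.mul_sum, h, mul_one]

theorem expansionExponent_eq_zero {ι : Type*} [DecidableEq ι] {R : ι → ι → Prop}
    [DecidableRel R] {S : Finset ι} {d : ι} :
    expansionExponent R S d = 0 ↔ d ∈ S ∧ ∀ e ∈ S, ¬ R e d := by
  simp [expansionExponent, Finset.filter_eq_empty_iff]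

theorem filter_expansionExponent_of_isMaximalCompatible {D : Finset ι}
    (hD : IsMaximalCompatible R D) :
    (Finset.univ.filter fun d => expansionExponent R D d = 0) = D := by
  ext d
  simp only [Finset.mem_filter_univ, expansionExponent_eq_zero]
  exact ⟨fun h => h.1, fun h => ⟨h, fun e he => hD.1 e he d h⟩⟩

/-- The d in S that cross no member of S form a compatible set, contained in a maximal one D of size
m. If it were all of D, every member of S would be compatible with D and hence lie in D, so that S =
D would be maximal. -/
theorem card_filter_expansionExponent_lt (hsymm : ∀ d e, R d e → R e d) (hirr : ∀ d, ¬ R d d)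
    (hcard : ∀ D, IsMaximalCompatible R D → D.card = m) {S : Finset ι}
    (hS : ¬ IsMaximalCompatible R S) :
    (Finset.univ.filter fun d => expansionExponent R S d = 0).card < m := by
  obtain ⟨D, hND, hD⟩ := exists_isMaximalCompatible_of_compatible hsymm hirr
    (N := Finset.univ.filter fun d => expansionExponent R S d = 0) (by
      simp only [Finset.mem_filter_univ, expansionExponent_eq_zero]
      exact fun d hd e he => he.2 d hd.1)
  rw [← hcard D hD]
  refine Finset.card_lt_card (hND.ssubset_of_ne fun h => hS ?_)
  have hDS : ∀ d, d ∈ D ↔ d ∈ S ∧ ∀ e ∈ S, ¬ R e d := fun d => by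
    rw [← h, Finset.mem_filter_univ, expansionExponent_eq_zero]
  have : S = D := by
    ext e
    refine ⟨fun he => hD.2 e fun d hd => ?_, fun he => ((hDS e).1 he).1⟩
    exact ((hDS d).1 hd).2 e he
  rwa [this]

/-- The field theory limit: the leading behaviour at the origin of the continued integral. -/
theorem tendsto_pow_mul_continuation [DecidablePred (IsMaximalCompatible R)]
    (hsymm : ∀ d e, R d e → R e d) (hirr : ∀ d, ¬ R d d)
    (hu : ∀ d t, C.u d t + ∏ e with R d e, C.u e t = 1)
    (hcard : ∀ D, IsMaximalCompatible R D → D.card = m)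
    (hlim : ∀ D, IsMaximalCompatible R D → ∀ a : ι → ℕ, (∀ d, a d = 0 ↔ d ∈ D) →
      Tendsto (fun ε : ℝ => (ε : ℂ) ^ m * C.integral fun d => ε + a d) (𝓝[>] 0) (𝓝 1))
    {G : (ι → ℂ) → ℂ} (hG : DifferentiableOn ℂ G {X | ∀ d, ∀ k : ℕ, X d ≠ -(k : ℂ)})
    (hGJ : ∀ X : ι → ℂ, (∀ d, 0 < (X d).re) → G X = C.integral X)
    {X : ι → ℂ} (hX : ∀ d, X d ≠ 0) :
    Tendsto (fun α : ℂ => α ^ m * G (α • X)) (𝓝[≠] 0)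
      (𝓝 (∑ D with IsMaximalCompatible R D, ∏ d ∈ D, 1 / X d)) := by
  set N : Finset ι → Finset ι := fun S =>
    Finset.univ.filter fun d => expansionExponent R S d = 0 with hN
  choose H hH hHJ using fun S : Finset ι =>
    C.exists_differentiableOn_mul_prod _ (expansionExponent R S) rfl
  have hopen : IsOpen {X : ι → ℂ | ∀ d, -1 < (X d).re} := isOpen_setOf_forall_lt_re (-1)
  have hEq : EqOn G (fun Y => ∑ S : Finset ι, H S Y / ∏ d ∈ N S, Y d)
      ({X | ∀ d, -1 < (X d).re} ∩ {X | ∀ d, ∀ k : ℕ, X d ≠ -(k : ℂ)}) := by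
    refine eqOn_of_eq_of_re_pos hopen (convex_setOf_forall_neg_lt_re fun _ => (1 : ℝ))
      (fun X hX d => by linarith [hX d]) (hG.mono inter_subset_right)
      (DifferentiableOn.fun_sum fun S _ => ?_) fun Y hY => ?_
    · simp only [div_eq_mul_inv]
      refine ((hH S).mono inter_subset_left).mul
        ((differentiable_prod_apply _).differentiableOn.inv fun Y hY => ?_)
      exact Finset.prod_ne_zero_iff.2 fun d _ => by simpa using hY.2 d 0
    · rw [hGJ Y hY, C.integral_eq_sum_expansionExponent hu hY]
      refine Finset.sum_congr rfl fun S _ => ?_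
      rw [hHJ S Y hY, mul_div_cancel_right₀]
      exact Finset.prod_ne_zero_iff.2 fun d _ h => by simpa [h] using hY d
  have hev : ∀ᶠ α : ℂ in 𝓝[≠] 0, α ^ m * G (α • X) =
      ∑ S : Finset ι, α ^ m / α ^ (N S).card * H S (α • X) / ∏ d ∈ N S, X d := by
    -- For ‖α X_d‖ < 1 the point lies in Re > -1, and the only hyperplane that it could meet is X_d
    -- = 0.
    have h1 : ∀ᶠ α : ℂ in 𝓝 0, ∀ d, ‖α * X d‖ < 1 := by
      rw [eventually_all]
      intro d
      have : Continuous fun α : ℂ => ‖α * X d‖ := by fun_prop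
      exact this.continuousAt.eventually_lt continuousAt_const (by simp)
    filter_upwards [h1.filter_mono nhdsWithin_le_nhds, self_mem_nhdsWithin] with α hα hα0
    have hα0 : α ≠ 0 := hα0
    rw [hEq ⟨fun d => ?_, fun d k => ?_⟩, Finset.mul_sum]
    · refine Finset.sum_congr rfl fun S _ => ?_
      simp only [Pi.smul_apply, smul_eq_mul, Finset.prod_mul_distrib, Finset.prod_const]
      field_simp
    · have := neg_le_of_abs_le (Complex.abs_re_le_norm (α * X d))
      have := hα d
      simp only [Pi.smul_apply, smul_eq_mul]
      linarith
    · intro h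
      have h2 := hα d
      simp only [Pi.smul_apply, smul_eq_mul] at h
      rw [h, norm_neg, Complex.norm_natCast] at h2
      have : k = 0 := by
        have : k < 1 := by exact_mod_cast h2
        omega
      subst this
      simp [hα0, hX d] at h
  refine Tendsto.congr' (hev.mono fun _ h => h.symm) ?_
  rw [Finset.sum_filter]
  refine tendsto_finsetSum _ fun S _ => ?_
  have hH0 : Tendsto (fun α : ℂ => H S (α • X)) (𝓝[≠] 0) (𝓝 (H S 0)) := by
    have h1 : ContinuousAt (H S) 0 :=
      ((hH S).differentiableAt (hopen.mem_nhds fun d => by simp)).continuousAt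
    have h2 : Tendsto (fun α : ℂ => α • X) (𝓝[≠] 0) (𝓝 0) := by
      have : Continuous fun α : ℂ => α • X := by fun_prop
      simpa using (this.tendsto 0).mono_left nhdsWithin_le_nhds
    exact h1.tendsto.comp h2
  split_ifs with hS
  · have hNS : N S = S := filter_expansionExponent_of_isMaximalCompatible hS
    -- `H S` is continuous at 0, so its value there can be read off along the ray on which all
    -- exponents equal ε.
    have hH1 : H S 0 = 1 := by
      have h1 : ContinuousAt (H S) 0 :=
        ((hH S).differentiableAt (hopen.mem_nhds fun d => by simp)).continuousAt
      have h2 : Tendsto (fun ε : ℝ => fun _ : ι => (ε : ℂ)) (𝓝[>] 0) (𝓝 0) := by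
        have : Continuous fun ε : ℝ => fun _ : ι => (ε : ℂ) := by fun_prop
        simpa [Pi.zero_def] using (this.tendsto 0).mono_left nhdsWithin_le_nhds
      refine tendsto_nhds_unique (h1.tendsto.comp h2) ?_
      refine (hlim S hS (expansionExponent R S) fun d => ?_).congr' ?_
      · rw [expansionExponent_eq_zero]
        exact ⟨fun h => h.1, fun h => ⟨h, fun e he => hS.1 e he d h⟩⟩
      · filter_upwards [self_mem_nhdsWithin] with ε hε
        rw [Function.comp, hHJ S _ fun d => by simpa using hε]
        rw [filter_expansionExponent_of_isMaximalCompatible hS, Finset.prod_const, hcard S hS,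
          mul_comm]
    have h3 : Tendsto (fun α : ℂ => H S (α • X) / ∏ d ∈ N S, X d) (𝓝[≠] 0)
        (𝓝 (∏ d ∈ S, 1 / X d)) := by
      have := hH0.div_const (∏ d ∈ N S, X d)
      rw [hNS] at this ⊢
      rwa [hH1, ← Finset.prod_const_one (s := S), ← Finset.prod_div_distrib] at this
    refine h3.congr' ?_
    filter_upwards [self_mem_nhdsWithin] with α hα
    have hα : α ≠ 0 := hα
    rw [hNS, hcard S hS, div_self (pow_ne_zero _ hα), one_mul]
  · have hlt : (N S).card < m := card_filter_expansionExponent_lt hsymm hirr hcard hS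
    have h1 : Tendsto (fun α : ℂ => α ^ (m - (N S).card) * H S (α • X) / ∏ d ∈ N S, X d) (𝓝[≠] 0)
        (𝓝 0) := by
      have h2 : Tendsto (fun α : ℂ => α ^ (m - (N S).card)) (𝓝[≠] 0) (𝓝 0) := by
        have := ((continuous_pow (M := ℂ) (m - (N S).card)).tendsto 0).mono_left
          (nhdsWithin_le_nhds (s := {0}ᶜ))
        rwa [zero_pow (by omega)] at this
      simpa using (h2.mul hH0).div_const (∏ d ∈ N S, X d)
    refine h1.congr' ?_
    filter_upwards [self_mem_nhdsWithin] with α hα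
    rw [pow_sub₀ _ hα hlt.le, ← div_eq_mul_inv (α ^ m)]

end DihedralChart

/-! ### Interval coordinates and the u-equations. -/

/-- The proper nonempty subintervals `[p, q]` of `[1, g]`, as pairs `(p, q)`. -/
def tubes (g : ℕ) : Finset (ℕ × ℕ) :=
  (Finset.Icc 1 g ×ˢ Finset.Icc 1 g).filter fun I => I.1 ≤ I.2 ∧ ¬ (I.1 = 1 ∧ I.2 = g)

theorem mem_tubes {g : ℕ} {I : ℕ × ℕ} :
    I ∈ tubes g ↔ 1 ≤ I.1 ∧ I.1 ≤ I.2 ∧ I.2 ≤ g ∧ ¬ (I.1 = 1 ∧ I.2 = g) := by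
  simp only [tubes, Finset.mem_filter, Finset.mem_product, Finset.mem_Icc]
  omega

/-- The tubes of the path with vertices `1, …, g`. -/
abbrev Tube (g : ℕ) := {I : ℕ × ℕ // I ∈ tubes g}

/-- Two intervals are incompatible if they are neither nested nor separated by a gap. -/
def TubeCrosses (I J : ℕ × ℕ) : Prop :=
  (I.1 < J.1 ∧ J.1 ≤ I.2 + 1 ∧ I.2 < J.2) ∨ (J.1 < I.1 ∧ I.1 ≤ J.2 + 1 ∧ J.2 < I.2)

instance (I J : ℕ × ℕ) : Decidable (TubeCrosses I J) := by
  unfold TubeCrosses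
  infer_instance

/-- The sum of the gaps in `[p, q]`, normalized to `1` if the interval reaches beyond `[1, g]`. -/
noncomputable def gapSum (g : ℕ) (y : ℕ → ℝ) (p q : ℕ) : ℝ :=
  if p = 0 ∨ q = g + 1 then 1 else ∑ k ∈ Finset.Icc p q, y k

/-- The dihedral coordinate that belongs to an interval. -/
noncomputable def tubeU (g : ℕ) (y : ℕ → ℝ) (I : ℕ × ℕ) : ℝ :=
  gapSum g y I.1 I.2 * gapSum g y (I.1 - 1) (I.2 + 1) /
    (gapSum g y (I.1 - 1) I.2 * gapSum g y I.1 (I.2 + 1))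

section

variable {g : ℕ} {y : ℕ → ℝ}

theorem gapSum_pos (hy : ∀ k, 0 < y k) {p q : ℕ} (hpq : p ≤ q) : 0 < gapSum g y p q := by
  unfold gapSum
  split_ifs
  · exact one_pos
  · exact Finset.sum_pos (fun k _ => hy k) ⟨p, by simpa using hpq⟩

theorem gapSum_zero_left (q : ℕ) : gapSum g y 0 q = 1 := by simp [gapSum]

theorem gapSum_right (p : ℕ) : gapSum g y p (g + 1) = 1 := by simp [gapSum]

theorem gapSum_of_mem {p q : ℕ} (hp : 1 ≤ p) (hq : q ≤ g) :
    gapSum g y p q = ∑ k ∈ Finset.Icc p q, y k := by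
  rw [gapSum, if_neg (by omega)]

theorem gapSum_succ_right {p q : ℕ} (hp : 1 ≤ p) (hpq : p ≤ q + 1) (hq : q + 1 ≤ g) :
    gapSum g y p (q + 1) = gapSum g y p q + y (q + 1) := by
  rw [gapSum_of_mem hp hq, gapSum_of_mem hp (by omega), Finset.sum_Icc_succ_top hpq]

theorem gapSum_pred_left {p q : ℕ} (hp : 1 ≤ p) (hpq : p ≤ q) (hq : q ≤ g) :
    gapSum g y p q = y p + gapSum g y (p + 1) q := by
  rw [gapSum_of_mem hp hq, gapSum_of_mem (by omega) hq, ← Finset.add_sum_Ioc_eq_sum_Icc hpq,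
    Finset.Icc_add_one_left_eq_Ioc]

theorem gapSum_self {k : ℕ} (hk : 1 ≤ k) (hkg : k ≤ g) : gapSum g y k k = y k := by
  simp [gapSum_of_mem hk hkg]

theorem prod_Icc_div_succ (f : ℕ → ℝ) {q r : ℕ} (hqr : q ≤ r + 1)
    (hf : ∀ b, q ≤ b → b ≤ r + 1 → f b ≠ 0) :
    ∏ b ∈ Finset.Icc q r, f b / f (b + 1) = f q / f (r + 1) := by
  obtain rfl | hlt := eq_or_lt_of_le hqr
  · simp [hf _ le_rfl le_rfl]
  · have hqr' : q ≤ r := by omega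
    clear hqr hlt
    induction r, hqr' using Nat.le_induction with
    | base => simp
    | succ r hr ih =>
      rw [Finset.prod_Icc_succ_top (by omega), ih fun b h1 h2 => hf b h1 (by omega)]
      have := hf (r + 1) (by omega) (by omega)
      field_simp

theorem tubeU_pos (hy : ∀ k, 0 < y k) {I : ℕ × ℕ} (hI : I.1 ≤ I.2) : 0 < tubeU g y I := by
  have h1 := gapSum_pos (g := g) hy hI
  have h2 := gapSum_pos (g := g) hy (show I.1 - 1 ≤ I.2 + 1 by omega)
  have h3 := gapSum_pos (g := g) hy (show I.1 - 1 ≤ I.2 by omega)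
  have h4 := gapSum_pos (g := g) hy (show I.1 ≤ I.2 + 1 by omega)
  unfold tubeU
  positivity

/-- The product of cross-ratios telescopes in both endpoints, and the boundary terms are normalized
to 1. -/
theorem prod_prod_tubeU (hy : ∀ k, 0 < y k) {p q : ℕ} (hpq : p ≤ q) (hq : q ≤ g) :
    ∏ a ∈ Finset.Icc 1 p, ∏ b ∈ Finset.Icc q g, tubeU g y (a, b) = gapSum g y p q := by
  have h1 : ∀ a ∈ Finset.Icc 1 p, ∏ b ∈ Finset.Icc q g, tubeU g y (a, b) =
      gapSum g y a q / gapSum g y (a - 1) q := fun a ha => by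
    have ha := Finset.mem_Icc.1 ha
    have h2 : ∀ b ∈ Finset.Icc q g, tubeU g y (a, b) =
        (gapSum g y a b / gapSum g y (a - 1) b) /
          (gapSum g y a (b + 1) / gapSum g y (a - 1) (b + 1)) := fun b hb => by
      rw [tubeU, div_div_div_eq]
    rw [Finset.prod_congr rfl h2,
      prod_Icc_div_succ (fun b => gapSum g y a b / gapSum g y (a - 1) b) (by omega)]
    · simp [gapSum_right]
    · exact fun b h3 _ => (div_pos (gapSum_pos hy (by omega)) (gapSum_pos hy (by omega))).ne'
  rw [Finset.prod_congr rfl h1]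
  clear h1
  induction p with
  | zero => simp [gapSum_zero_left]
  | succ p ih =>
    rw [Finset.prod_Icc_succ_top (by omega), ih (by omega), Nat.add_sub_cancel]
    exact mul_div_cancel₀ _ (gapSum_pos hy (by omega)).ne'

/-- The previous product runs over all intervals containing [p, q]; the full interval [1, g], which
is not a tube, is split off. -/
theorem gapSum_eq_mul_prod (hy : ∀ k, 0 < y k) {p q : ℕ} (hp : 1 ≤ p) (hpq : p ≤ q) (hq : q ≤ g) :
    gapSum g y p q = gapSum g y 1 g *
      ∏ e : Tube g, if e.1.1 ≤ p ∧ q ≤ e.1.2 then tubeU g y e.1 else 1 := by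
  rw [Finset.prod_coe_sort (tubes g)
    (fun e => if e.1 ≤ p ∧ q ≤ e.2 then tubeU g y e else 1), ← Finset.prod_filter,
    ← prod_prod_tubeU hy hpq hq, ← Finset.prod_product']
  have h1 : gapSum g y 1 g = tubeU g y (1, g) := by
    simp [tubeU, gapSum_zero_left, gapSum_right]
  rw [h1, ← Finset.prod_insert (f := tubeU g y) (by simp [mem_tubes])]
  congr 1
  ext ⟨a, b⟩
  simp only [Finset.mem_product, Finset.mem_Icc, Finset.mem_insert, Finset.mem_filter, mem_tubes,
    Prod.mk.injEq]
  omega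

/-- In the quotient of the two product formulas the tubes containing [p, q] cancel. This expresses
ratios of gaps as monomials in the u's, the source of both the u-equations and the derivative
formulas. -/
theorem gap_div_gapSum (hy : ∀ k, 0 < y k) {p k q : ℕ} (hp : 1 ≤ p) (hpk : p ≤ k) (hkq : k ≤ q)
    (hq : q ≤ g) :
    y k / gapSum g y p q = ∏ e : Tube g,
      if (e.1.1 ≤ k ∧ k ≤ e.1.2) ∧ ¬ (e.1.1 ≤ p ∧ q ≤ e.1.2) then tubeU g y e.1 else 1 := by
  rw [div_eq_iff (gapSum_pos hy (by omega)).ne', ← gapSum_self (g := g) (y := y) (k := k) (by omega) (by omega),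
    gapSum_eq_mul_prod hy (p := k) (by omega) le_rfl (by omega),
    gapSum_eq_mul_prod hy (p := p) (q := q) hp (by omega) hq, mul_left_comm,
    ← Finset.prod_mul_distrib]
  congr 1
  refine Finset.prod_congr rfl fun e _ => ?_
  split_ifs <;> first | omega | simp

/-- The `u`-equations. -/
theorem tubeU_add_prod_crosses (hy : ∀ k, 0 < y k) (d : Tube g) :
    tubeU g y d.1 + ∏ e : Tube g with TubeCrosses d.1 e.1, tubeU g y e.1 = 1 := by
  obtain ⟨⟨p, q⟩, hd⟩ := d
  obtain ⟨hp, hpq, hq, hne⟩ := mem_tubes.1 hd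
  simp only at hp hpq hq hne ⊢
  -- A tube crossing [p, q] either contains p - 1 and ends before q, or contains q + 1 and starts
  -- after p. The two products A and B are the gap ratios y_{p-1}/gap[p-1, q] and y_{q+1}/gap[p,
  -- q+1], with value 1 where [p, q] touches the corresponding end of [1, g].
  set A := ∏ e : Tube g, if (e.1.1 ≤ p - 1 ∧ p - 1 ≤ e.1.2) ∧ ¬ (e.1.1 ≤ p - 1 ∧ q ≤ e.1.2)
    then tubeU g y e.1 else 1 with hA
  set B := ∏ e : Tube g, if (e.1.1 ≤ q + 1 ∧ q + 1 ≤ e.1.2) ∧ ¬ (e.1.1 ≤ p ∧ q + 1 ≤ e.1.2)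
    then tubeU g y e.1 else 1 with hB
  have hAB : ∏ e : Tube g with TubeCrosses (p, q) e.1, tubeU g y e.1 = A * B := by
    rw [hA, hB, ← Finset.prod_mul_distrib, Finset.prod_filter]
    refine Finset.prod_congr rfl fun e _ => ?_
    have he := mem_tubes.1 e.2
    by_cases h : TubeCrosses (p, q) e.1
    · rw [if_pos h]
      simp only [TubeCrosses] at h
      split_ifs <;> first | omega | simp
    · rw [if_neg h]
      simp only [TubeCrosses] at h
      split_ifs <;> first | omega | simp
  have hA' : A = (if p = 1 then 1 else y (p - 1)) / gapSum g y (p - 1) q := by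
    split_ifs with h
    · subst h
      simp only [Nat.sub_self, gapSum_zero_left, div_one]
      refine Finset.prod_eq_one fun e _ => if_neg ?_
      have he := mem_tubes.1 e.2
      omega
    · rw [gap_div_gapSum hy (by omega) le_rfl (by omega) hq]
  have hB' : B = (if q = g then 1 else y (q + 1)) / gapSum g y p (q + 1) := by
    split_ifs with h
    · subst h
      simp only [gapSum_right, div_one]
      refine Finset.prod_eq_one fun e _ => if_neg ?_
      have he := mem_tubes.1 e.2
      omega
    · rw [gap_div_gapSum hy (by omega) (by omega) le_rfl (by omega)]
  have h3 := gapSum_pos (g := g) hy (show p - 1 ≤ q by omega)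
  have h4 := gapSum_pos (g := g) hy (show p ≤ q + 1 by omega)
  rw [hAB, hA', hB', tubeU, div_mul_div_comm, ← add_div,
    div_eq_one_iff_eq (mul_pos h3 h4).ne']
  obtain ⟨p, rfl⟩ : ∃ p', p = p' + 1 := ⟨p - 1, by omega⟩
  simp only [Nat.add_sub_cancel]
  by_cases h1 : p = 0
  · subst h1
    rw [if_neg (show ¬ q = g by simpa using hne)]
    simp only [gapSum_zero_left, zero_add, if_true]
    rw [gapSum_succ_right le_rfl (by omega) (by simp at hne; omega)]
    ring
  · have e1 : gapSum g y p q = y p + gapSum g y (p + 1) q :=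
      gapSum_pred_left (by omega) (by omega) hq
    rw [if_neg (by omega), e1]
    by_cases h2 : q = g
    · subst h2
      simp only [gapSum_right, if_true]
      ring
    · rw [if_neg h2, gapSum_succ_right (p := p) (by omega) (by omega) (by omega),
        gapSum_succ_right (p := p + 1) (by omega) (by omega) (by omega), e1]
      ring

theorem tubeU_le_one (hy : ∀ k, 0 < y k) (d : Tube g) : tubeU g y d.1 ≤ 1 := by
  rw [← tubeU_add_prod_crosses hy d]
  refine le_add_of_nonneg_right (Finset.prod_nonneg fun e _ => (tubeU_pos hy ?_).le)
  exact (mem_tubes.1 e.2).2.1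

/-! ### Scaling of the gaps and logarithmic derivatives. -/

theorem gapSum_scale {y' : ℕ → ℝ} {c : ℝ} (h : ∀ k, 1 ≤ k → k ≤ g → y' k = c * y k) {p q : ℕ}
    (hp : 1 ≤ p) (hq : q ≤ g) : gapSum g y' p q = c * gapSum g y p q := by
  rw [gapSum_of_mem hp hq, gapSum_of_mem hp hq, Finset.mul_sum]
  refine Finset.sum_congr rfl fun k hk => ?_
  have := Finset.mem_Icc.1 hk
  exact h k (by omega) (by omega)

/-- Every u is homogeneous of degree 0 in the gaps, also when boundary sums are replaced by 1. This
permits the normalization y_1 = 1. -/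
theorem tubeU_scale {y' : ℕ → ℝ} {c : ℝ} (hc : c ≠ 0)
    (h : ∀ k, 1 ≤ k → k ≤ g → y' k = c * y k) (d : Tube g) : tubeU g y' d.1 = tubeU g y d.1 := by
  obtain ⟨⟨p, q⟩, hd⟩ := d
  obtain ⟨hp, hpq, hq, hne⟩ := mem_tubes.1 hd
  simp only at hp hpq hq hne
  simp only [tubeU]
  by_cases h1 : p = 1
  · subst h1
    rw [gapSum_scale h le_rfl hq, gapSum_scale h le_rfl (by simp at hne; omega)]
    simp only [Nat.sub_self, gapSum_zero_left, mul_one, one_mul]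
    exact mul_div_mul_left _ _ hc
  · rw [gapSum_scale h hp hq, gapSum_scale h (by omega) hq]
    by_cases h2 : q = g
    · subst h2
      simp only [gapSum_right, mul_one]
      exact mul_div_mul_left _ _ hc
    · rw [gapSum_scale h (by omega) (by omega), gapSum_scale h (by omega) (by omega)]
      rw [mul_mul_mul_comm, mul_mul_mul_comm c _ c]
      exact mul_div_mul_left _ _ (mul_ne_zero hc hc)

/-- The logarithmic derivative of `gapSum` under scaling of the gaps in the interval `I`. -/
noncomputable def logDerivGapSum (g : ℕ) (y : ℕ → ℝ) (I : ℕ × ℕ) (p q : ℕ) : ℝ :=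
  if p = 0 ∨ q = g + 1 then 0
  else ∑ k ∈ Finset.Icc p q, (if I.1 ≤ k ∧ k ≤ I.2 then 1 else 0) * (y k / gapSum g y p q)

theorem hasDerivAt_gapSum (hy : ∀ k, 0 < y k) (I : ℕ × ℕ) {p q : ℕ} (hpq : p ≤ q) :
    HasDerivAt (fun s : ℝ =>
      gapSum g (fun k => y k * Real.exp (s * if I.1 ≤ k ∧ k ≤ I.2 then 1 else 0)) p q)
      (gapSum g y p q * logDerivGapSum g y I p q) 0 := by
  unfold logDerivGapSum
  split_ifs with h
  · simpa [gapSum, h] using hasDerivAt_const (0 : ℝ) (1 : ℝ)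
  · simp only [gapSum, if_neg h]
    have h1 : ∀ k ∈ Finset.Icc p q, HasDerivAt
        (fun s : ℝ => y k * Real.exp (s * if I.1 ≤ k ∧ k ≤ I.2 then 1 else 0))
        (y k * if I.1 ≤ k ∧ k ≤ I.2 then 1 else 0) 0 := fun k _ => by
      have := (((hasDerivAt_id (0 : ℝ)).mul_const
        (if I.1 ≤ k ∧ k ≤ I.2 then (1 : ℝ) else 0)).exp).const_mul (y k)
      simpa using this
    refine (HasDerivAt.fun_sum h1).congr_deriv ?_
    rw [Finset.mul_sum]
    refine Finset.sum_congr rfl fun k _ => ?_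
    have := (gapSum_pos (g := g) hy hpq).ne'
    rw [gapSum, if_neg h] at this
    field_simp

theorem hasDerivAt_tubeU (hy : ∀ k, 0 < y k) (I : ℕ × ℕ) {e : ℕ × ℕ} (he : e.1 ≤ e.2) :
    HasDerivAt (fun s : ℝ =>
      tubeU g (fun k => y k * Real.exp (s * if I.1 ≤ k ∧ k ≤ I.2 then 1 else 0)) e)
      (tubeU g y e * (logDerivGapSum g y I e.1 e.2 + logDerivGapSum g y I (e.1 - 1) (e.2 + 1) -
        logDerivGapSum g y I (e.1 - 1) e.2 - logDerivGapSum g y I e.1 (e.2 + 1))) 0 := by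
  have h1 := (gapSum_pos (g := g) hy (show e.1 - 1 ≤ e.2 by omega)).ne'
  have h2 := (gapSum_pos (g := g) hy (show e.1 ≤ e.2 + 1 by omega)).ne'
  have := ((hasDerivAt_gapSum (g := g) hy I he).mul
    (hasDerivAt_gapSum (g := g) hy I (show e.1 - 1 ≤ e.2 + 1 by omega))).div
    ((hasDerivAt_gapSum (g := g) hy I (show e.1 - 1 ≤ e.2 by omega)).mul
      (hasDerivAt_gapSum (g := g) hy I (show e.1 ≤ e.2 + 1 by omega))) (by simp [h1, h2])
  refine this.congr_deriv ?_
  simp only [zero_mul, Real.exp_zero, mul_one, Pi.mul_apply, tubeU]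
  field_simp
  ring

end

/-- Functions of the gaps that are linear combinations of monomials in the dihedral coordinates,
all of them divisible by the coordinate of `I`. -/
def HasExpansion (g : ℕ) (I : Tube g) (F : (ℕ → ℝ) → ℝ) : Prop :=
  ∃ c : (Tube g → ℕ) →₀ ℝ, (∀ a ∈ c.support, 1 ≤ a I) ∧ ∀ y, (∀ k, 0 < y k) →
    F y = c.sum fun a r => r * ∏ e, tubeU g y e.1 ^ a e

namespace HasExpansion

variable {g : ℕ} {I : Tube g} {F F' : (ℕ → ℝ) → ℝ}

theorem zero : HasExpansion g I fun _ => 0 := ⟨0, by simp, by simp⟩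

theorem add (h : HasExpansion g I F) (h' : HasExpansion g I F') :
    HasExpansion g I fun y => F y + F' y := by
  classical
  obtain ⟨c, hc, hF⟩ := h
  obtain ⟨c', hc', hF'⟩ := h'
  refine ⟨c + c', fun a ha => ?_, fun y hy => ?_⟩
  · rcases Finset.mem_union.1 (Finsupp.support_add ha) with h | h
    · exact hc a h
    · exact hc' a h
  · beta_reduce
    rw [hF y hy, hF' y hy, Finsupp.sum_add_index' (by simp) (by intros; ring)]

theorem sub (h : HasExpansion g I F) (h' : HasExpansion g I F') :
    HasExpansion g I fun y => F y - F' y := by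
  classical
  obtain ⟨c, hc, hF⟩ := h
  obtain ⟨c', hc', hF'⟩ := h'
  refine ⟨c - c', fun a ha => ?_, fun y hy => ?_⟩
  · rcases Finset.mem_union.1 (Finsupp.support_sub ha) with h | h
    · exact hc a h
    · exact hc' a h
  · beta_reduce
    rw [hF y hy, hF' y hy, Finsupp.sum_sub_index (by intros; ring)]

theorem sum {s : Finset ℕ} {F : ℕ → (ℕ → ℝ) → ℝ} (h : ∀ k ∈ s, HasExpansion g I (F k)) :
    HasExpansion g I fun y => ∑ k ∈ s, F k y := by
  induction s using Finset.induction_on with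
  | empty => simpa using zero
  | insert k s hk ih =>
    simp only [Finset.sum_insert hk]
    exact (h k (Finset.mem_insert_self _ _)).add
      (ih fun j hj => h j (Finset.mem_insert_of_mem hj))

theorem congr (h : HasExpansion g I F) (hF : ∀ y, (∀ k, 0 < y k) → F' y = F y) :
    HasExpansion g I F' := by
  obtain ⟨c, hc, h⟩ := h
  exact ⟨c, hc, fun y hy => by rw [hF y hy, h y hy]⟩

/-- If [p, q] lies in I, the whole sum is scaled and the logarithmic derivative is 1. Otherwise it
is a sum of ratios y_k/gap[p, q] with k in I; by `gap_div_gapSum` each is a monomial that contains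
u_I, because I contains k but not [p, q]. -/
theorem logDerivGapSum_sub {p q : ℕ} (hpq : p ≤ q) (hq : q ≤ g + 1) :
    HasExpansion g I fun y => logDerivGapSum g y I.1 p q -
      if I.1.1 ≤ p ∧ q ≤ I.1.2 then 1 else 0 := by
  have hI := mem_tubes.1 I.2
  by_cases h : p = 0 ∨ q = g + 1
  · refine zero.congr fun y _ => ?_
    rw [logDerivGapSum, if_pos h, if_neg (by omega), sub_zero]
  simp only [logDerivGapSum, if_neg h]
  by_cases h1 : I.1.1 ≤ p ∧ q ≤ I.1.2
  · refine zero.congr fun y hy => ?_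
    rw [if_pos h1, Finset.sum_congr rfl fun k hk => by
      rw [if_pos (by have := Finset.mem_Icc.1 hk; omega), one_mul], ← Finset.sum_div,
      ← gapSum_of_mem (g := g) (by omega) (by omega), div_self (gapSum_pos hy hpq).ne', sub_self]
  · simp only [if_neg h1, sub_zero]
    refine sum fun k hk => ?_
    have hk := Finset.mem_Icc.1 hk
    by_cases h2 : I.1.1 ≤ k ∧ k ≤ I.1.2
    · refine ⟨Finsupp.single (fun e => if (e.1.1 ≤ k ∧ k ≤ e.1.2) ∧ ¬ (e.1.1 ≤ p ∧ q ≤ e.1.2)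
        then 1 else 0) 1, fun a ha => ?_, fun y hy => ?_⟩
      · have := Finset.mem_singleton.1 (Finsupp.support_single_subset ha)
        rw [this]
        exact (if_pos ⟨h2, h1⟩).ge
      · beta_reduce
        rw [if_pos h2, Finsupp.sum_single_index (by simp), one_mul, one_mul,
          gap_div_gapSum hy (by omega) hk.1 hk.2 (by omega)]
        simp only [pow_ite, pow_one, pow_zero]
    · refine zero.congr fun y _ => ?_
      rw [if_neg h2, zero_mul]

theorem logDeriv_tubeU_sub (I e : Tube g) :
    HasExpansion g I fun y => (logDerivGapSum g y I.1 e.1.1 e.1.2 +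
      logDerivGapSum g y I.1 (e.1.1 - 1) (e.1.2 + 1) - logDerivGapSum g y I.1 (e.1.1 - 1) e.1.2 -
      logDerivGapSum g y I.1 e.1.1 (e.1.2 + 1)) - if I = e then 1 else 0 := by
  have he := mem_tubes.1 e.2
  have hI := mem_tubes.1 I.2
  refine ((((logDerivGapSum_sub (I := I) (p := e.1.1) (q := e.1.2) (by omega) (by omega)).add
    (logDerivGapSum_sub (p := e.1.1 - 1) (q := e.1.2 + 1) (by omega) (by omega))).sub
    (logDerivGapSum_sub (p := e.1.1 - 1) (q := e.1.2) (by omega) (by omega))).sub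
    (logDerivGapSum_sub (p := e.1.1) (q := e.1.2 + 1) (by omega) (by omega))).congr fun y hy => ?_
  -- The mixed second difference of the indicator of [p, q] ⊆ I is the Kronecker delta at I.
  have h : (if I = e then (1 : ℝ) else 0) = (if I.1.1 ≤ e.1.1 ∧ e.1.2 ≤ I.1.2 then 1 else 0) +
      (if I.1.1 ≤ e.1.1 - 1 ∧ e.1.2 + 1 ≤ I.1.2 then 1 else 0) -
      (if I.1.1 ≤ e.1.1 - 1 ∧ e.1.2 ≤ I.1.2 then 1 else 0) -
      (if I.1.1 ≤ e.1.1 ∧ e.1.2 + 1 ≤ I.1.2 then 1 else 0) := by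
    have : I = e ↔ I.1.1 = e.1.1 ∧ I.1.2 = e.1.2 := by rw [Subtype.ext_iff, Prod.ext_iff]
    simp only [this]
    split_ifs <;> first | omega | norm_num
  rw [h]
  ring

end HasExpansion

/-! ### The chart in logarithmic coordinates. -/

section

variable {m : ℕ}

/-- The logarithms of the gaps `1, …, m + 1`, of which the first is normalized to `0`. -/
def logGap (t : Fin m → ℝ) (k : ℕ) : ℝ := if h : 2 ≤ k ∧ k < m + 2 then t ⟨k - 2, by omega⟩ else 0

/-- The gaps `1, …, m + 1` in logarithmic coordinates. -/
noncomputable def expGap (t : Fin m → ℝ) (k : ℕ) : ℝ := Real.exp (logGap t k)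

/-- The direction in which the gaps in `I` are scaled. -/
def tubeDir (m : ℕ) (I : ℕ × ℕ) (i : Fin m) : ℝ :=
  (if I.1 ≤ i + 2 ∧ i + 2 ≤ I.2 then 1 else 0) - if I.1 ≤ 1 ∧ 1 ≤ I.2 then 1 else 0

theorem expGap_pos (t : Fin m → ℝ) (k : ℕ) : 0 < expGap t k := Real.exp_pos _

theorem expGap_one (t : Fin m → ℝ) : expGap t 1 = 1 := by simp [expGap, logGap]

theorem logGap_add_two (t : Fin m → ℝ) (i : Fin m) : logGap t (i + 2) = t i := by simp [logGap]

theorem expGap_add_two (t : Fin m → ℝ) (i : Fin m) : expGap t (i + 2) = Real.exp (t i) := by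
  rw [expGap, logGap_add_two]

theorem logGap_add_smul (t v : Fin m → ℝ) (s : ℝ) (k : ℕ) :
    logGap (t + s • v) k = logGap t k + s * logGap v k := by
  unfold logGap
  split_ifs <;> simp

theorem continuous_logGap (k : ℕ) : Continuous fun t : Fin m → ℝ => logGap t k := by
  unfold logGap
  split_ifs <;> fun_prop

theorem logGap_tubeDir (I : ℕ × ℕ) {k : ℕ} (h1 : 1 ≤ k) (hk : k ≤ m + 1) :
    logGap (tubeDir m I) k =
      (if I.1 ≤ k ∧ k ≤ I.2 then 1 else 0) - if I.1 ≤ 1 ∧ 1 ≤ I.2 then 1 else 0 := by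
  obtain rfl | h : k = 1 ∨ 2 ≤ k := by omega
  · simp [logGap]
  · rw [logGap, dif_pos ⟨h, by omega⟩, tubeDir]
    simp only [Nat.sub_add_cancel h]

theorem continuous_gapSum (p q : ℕ) :
    Continuous fun t : Fin m → ℝ => gapSum (m + 1) (expGap t) p q := by
  unfold gapSum
  split_ifs
  · exact continuous_const
  · exact continuous_finsetSum _ fun k _ => Real.continuous_exp.comp (continuous_logGap k)

theorem continuous_tubeU {I : ℕ × ℕ} (hI : I.1 ≤ I.2) :
    Continuous fun t : Fin m → ℝ => tubeU (m + 1) (expGap t) I := by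
  refine ((continuous_gapSum _ _).mul (continuous_gapSum _ _)).div
    ((continuous_gapSum _ _).mul (continuous_gapSum _ _)) fun t => ?_
  exact (mul_pos (gapSum_pos (expGap_pos t) (by omega))
    (gapSum_pos (expGap_pos t) (by omega))).ne'

theorem tubeU_expGap_add_smul (I e : Tube (m + 1)) (t : Fin m → ℝ) (s : ℝ) :
    tubeU (m + 1) (expGap (t + s • tubeDir m I.1)) e.1 =
      tubeU (m + 1) (fun k => expGap t k *
        Real.exp (s * if I.1.1 ≤ k ∧ k ≤ I.1.2 then 1 else 0)) e.1 := by
  -- The constant undoes the normalization of the first gap, which `tubeDir` compensates for when 1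
  -- lies in I.
  refine tubeU_scale (c := Real.exp (-s * if I.1.1 ≤ 1 ∧ 1 ≤ I.1.2 then 1 else 0))
    (Real.exp_pos _).ne' (fun k h1 hk => ?_) e
  rw [expGap, logGap_add_smul, logGap_tubeDir _ h1 hk, expGap, ← Real.exp_add, ← Real.exp_add]
  congr 1
  ring

/-- As all u are at most 1, their full product is bounded by the sub-product equal to y_k/gap[1,
i+2]. Taking k = 1 bounds it by exp(-t_i), taking k = i + 2 bounds it by exp(t_i). -/
theorem prod_tubeU_le_exp_neg_abs (t : Fin m → ℝ) (i : Fin m) :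
    ∏ e : Tube (m + 1), tubeU (m + 1) (expGap t) e.1 ≤ Real.exp (-|t i|) := by
  have hy := expGap_pos t
  have key : ∀ k, 1 ≤ k → k ≤ (i : ℕ) + 2 → ∏ e : Tube (m + 1), tubeU (m + 1) (expGap t) e.1 ≤
      expGap t k / gapSum (m + 1) (expGap t) 1 (i + 2) := fun k h1 hk => by
    rw [gap_div_gapSum hy le_rfl h1 hk (by omega)]
    refine Finset.prod_le_prod (fun e _ => (tubeU_pos hy (mem_tubes.1 e.2).2.1).le) fun e _ => ?_
    split_ifs
    · exact le_rfl
    · exact tubeU_le_one hy e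
  have hle : ∀ k, 1 ≤ k → k ≤ (i : ℕ) + 2 →
      expGap t k ≤ gapSum (m + 1) (expGap t) 1 (i + 2) := fun k h1 hk => by
    rw [gapSum_of_mem le_rfl (by omega)]
    exact Finset.single_le_sum (f := expGap t) (fun k _ => (hy k).le) (by simp; omega)
  rcases abs_cases (t i) with ⟨h, -⟩ | ⟨h, -⟩
  · refine (key 1 le_rfl (by omega)).trans ?_
    rw [h, Real.exp_neg, ← expGap_add_two, expGap_one, one_div]
    exact inv_anti₀ (hy _) (hle _ (by omega) le_rfl)
  · refine (key (i + 2) (by omega) le_rfl).trans ?_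
    rw [h, neg_neg, ← expGap_add_two]
    refine div_le_self (hy _).le ?_
    rw [← expGap_one t]
    exact hle 1 le_rfl (by omega)

end

/-- The dihedral coordinates of the moduli space of `m + 3` points, as functions of the logarithms
of positive coordinates. -/
noncomputable def tubeChart (m : ℕ) : DihedralChart (Tube (m + 1)) m where
  u e t := tubeU (m + 1) (expGap t) e.1
  pos e t := tubeU_pos (expGap_pos t) (mem_tubes.1 e.2).2.1
  le_one e t := tubeU_le_one (expGap_pos t) e
  continuous_u e := continuous_tubeU (mem_tubes.1 e.2).2.1
  decay := prod_tubeU_le_exp_neg_abs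
  dir I := tubeDir m I.1
  coeff I e := (HasExpansion.logDeriv_tubeU_sub I e).choose
  one_le_of_mem_support I e := (HasExpansion.logDeriv_tubeU_sub I e).choose_spec.1
  hasLineDerivAt_u I e t := by
    unfold HasLineDerivAt
    simp only [tubeU_expGap_add_smul]
    have h1 := hasDerivAt_tubeU (g := m + 1) (expGap_pos t) I.1 (mem_tubes.1 e.2).2.1
    have h2 := (HasExpansion.logDeriv_tubeU_sub I e).choose_spec.2 _ (expGap_pos t)
    rw [← h2, add_sub_cancel]
    exact h1

/-! ### Maximal tubings: roots, cardinality and unimodularity. -/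

/-- Maximal families of pairwise compatible intervals in `[1, g]`, including `[1, g]` itself. -/
structure IsMaximalTubing (g : ℕ) (E : Finset (ℕ × ℕ)) : Prop where
  bounds : ∀ I ∈ E, 1 ≤ I.1 ∧ I.1 ≤ I.2 ∧ I.2 ≤ g
  top_mem : (1, g) ∈ E
  not_crosses : ∀ I ∈ E, ∀ J ∈ E, ¬ TubeCrosses I J
  mem_of_not_crosses : ∀ I : ℕ × ℕ, 1 ≤ I.1 → I.1 ≤ I.2 → I.2 ≤ g →
    (∀ J ∈ E, ¬ TubeCrosses I J) → I ∈ E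

/-- `I` is the smallest interval of the family `E` that contains `k`. -/
def IsTubeRoot (E : Finset (ℕ × ℕ)) (I : ℕ × ℕ) (k : ℕ) : Prop :=
  (I.1 ≤ k ∧ k ≤ I.2) ∧ ∀ J ∈ E, J.1 ≤ k ∧ k ≤ J.2 → J.1 ≤ I.1 ∧ I.2 ≤ J.2

namespace IsMaximalTubing

variable {g : ℕ} {E : Finset (ℕ × ℕ)} (hE : IsMaximalTubing g E)
include hE

/-- The root is the point just after the longest proper member of E with the same left end, or the
left end itself if there is none. -/
theorem exists_isTubeRoot_of_mem {I : ℕ × ℕ} (hI : I ∈ E) : ∃ k, IsTubeRoot E I k := by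
  have hIb := hE.bounds I hI
  by_cases h : ∃ J ∈ E, J.1 = I.1 ∧ J.2 < I.2
  · obtain ⟨J, hJ, hmax⟩ := Finset.exists_max_image
      (E.filter fun J => J.1 = I.1 ∧ J.2 < I.2) (fun J => J.2)
      (by obtain ⟨J, hJ, h⟩ := h; exact ⟨J, by simpa using ⟨hJ, h⟩⟩)
    obtain ⟨hJE, hJ1, hJ2⟩ := Finset.mem_filter.1 hJ
    have hJb := hE.bounds J hJE
    refine ⟨J.2 + 1, by omega, fun K hK hk => ?_⟩
    have hKb := hE.bounds K hK
    have h1 := hE.not_crosses K hK I hI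
    have h2 := hE.not_crosses K hK J hJE
    have h3 : K.1 = I.1 ∧ K.2 < I.2 → K.2 ≤ J.2 := fun h =>
      hmax K (Finset.mem_filter.2 ⟨hK, h⟩)
    simp only [TubeCrosses] at h1 h2
    omega
  · push Not at h
    refine ⟨I.1, by omega, fun K hK hk => ?_⟩
    have h1 := hE.not_crosses K hK I hI
    have h2 := h K hK
    simp only [TubeCrosses] at h1
    omega

theorem exists_mem_isTubeRoot {k : ℕ} (h1 : 1 ≤ k) (hk : k ≤ g) : ∃ I ∈ E, IsTubeRoot E I k := by
  obtain ⟨I, hI, hmin⟩ := Finset.exists_min_image (E.filter fun J => J.1 ≤ k ∧ k ≤ J.2)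
    (fun J => J.2 - J.1) ⟨(1, g), by simpa using ⟨hE.top_mem, h1, hk⟩⟩
  obtain ⟨hIE, hIk⟩ := Finset.mem_filter.1 hI
  refine ⟨I, hIE, hIk, fun J hJ hJk => ?_⟩
  have h2 := hE.not_crosses J hJ I hIE
  have h3 := hmin J (Finset.mem_filter.2 ⟨hJ, hJk⟩)
  simp only [TubeCrosses] at h2
  omega

/-- The part of I to the left of its root crosses no member of E, so maximality puts it in E;
similarly on the right. Hence roots are unique, and tubes match points of [1, g] as in a binary
search tree. -/
theorem left_mem {I : ℕ × ℕ} {k : ℕ} (hI : I ∈ E) (hk : IsTubeRoot E I k) (h : I.1 < k) :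
    (I.1, k - 1) ∈ E := by
  have hIb := hE.bounds I hI
  refine hE.mem_of_not_crosses _ hIb.1 (by simp only; omega) (by have := hk.1; simp only; omega)
    fun J hJ => ?_
  have hJb := hE.bounds J hJ
  have h1 := hE.not_crosses J hJ I hI
  have h2 := hk.2 J hJ
  have h3 := hk.1
  simp only [TubeCrosses] at h1 ⊢
  omega

theorem right_mem {I : ℕ × ℕ} {k : ℕ} (hI : I ∈ E) (hk : IsTubeRoot E I k) (h : k < I.2) :
    (k + 1, I.2) ∈ E := by
  have hIb := hE.bounds I hI
  refine hE.mem_of_not_crosses _ (by simp) (by simp only; omega) hIb.2.2 fun J hJ => ?_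
  have hJb := hE.bounds J hJ
  have h1 := hE.not_crosses J hJ I hI
  have h2 := hk.2 J hJ
  have h3 := hk.1
  simp only [TubeCrosses] at h1 ⊢
  omega

theorem isTubeRoot_unique {I : ℕ × ℕ} {k l : ℕ} (hI : I ∈ E) (hk : IsTubeRoot E I k)
    (hl : IsTubeRoot E I l) : k = l := by
  have key : ∀ {k l}, IsTubeRoot E I k → IsTubeRoot E I l → ¬ k < l := fun {k l} hk hl h => by
    have h1 := hk.2 _ (hE.left_mem hI hl (by have := hk.1; omega))
    have h2 := hk.1
    have h3 := hl.1
    simp only at h1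
    omega
  have h1 := key hk hl
  have h2 := key hl hk
  omega

/-- Take the smallest member containing [p, q]. Its root lies in [p, q], since otherwise the part of
it on one side of the root would be a smaller member containing [p, q]. -/
theorem exists_isTubeRoot_between {p q : ℕ} (hp : 1 ≤ p) (hpq : p ≤ q) (hq : q ≤ g) :
    ∃ I ∈ E, ∃ k, IsTubeRoot E I k ∧ p ≤ k ∧ k ≤ q ∧ I.1 ≤ p ∧ q ≤ I.2 := by
  obtain ⟨I, hI, hmin⟩ := Finset.exists_min_image (E.filter fun J => J.1 ≤ p ∧ q ≤ J.2)
    (fun J => J.2 - J.1) ⟨(1, g), by simpa using ⟨hE.top_mem, hp, hq⟩⟩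
  obtain ⟨hIE, hIpq⟩ := Finset.mem_filter.1 hI
  obtain ⟨k, hk⟩ := hE.exists_isTubeRoot_of_mem hIE
  have hkI := hk.1
  refine ⟨I, hIE, k, hk, ?_, ?_, hIpq⟩
  · by_contra! h
    have := hmin _ (Finset.mem_filter.2 ⟨hE.right_mem hIE hk (by omega), by simp only; omega⟩)
    simp only at this
    omega
  · by_contra! h
    have := hmin _ (Finset.mem_filter.2 ⟨hE.left_mem hIE hk (by omega), by simp only; omega⟩)
    simp only at this
    omega

theorem card_eq : E.card = g := by
  choose! r hr using fun I (hI : I ∈ E) => hE.exists_isTubeRoot_of_mem hI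
  rw [← Nat.card_Icc 1 g |>.trans (Nat.add_sub_cancel g 1)]
  refine Finset.card_bij (fun I _ => r I) (fun I hI => ?_) (fun I hI J hJ h => ?_) fun k hk => ?_
  · have := (hr I hI).1
    have := hE.bounds I hI
    simp only [Finset.mem_Icc]
    omega
  · have h1 := (hr I hI).2 J hJ (by rw [h]; exact (hr J hJ).1)
    have h2 := (hr J hJ).2 I hI (by rw [← h]; exact (hr I hI).1)
    ext <;> omega
  · have hk := Finset.mem_Icc.1 hk
    obtain ⟨I, hI, hIk⟩ := hE.exists_mem_isTubeRoot hk.1 hk.2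
    exact ⟨I, hI, hE.isTubeRoot_unique hI (hr I hI) hIk⟩

-- A triangular system: the shortest interval occurs only in its own equation, so its unknown can be
-- chosen last, without division.
omit hE in
theorem exists_sum_eq (E : Finset (ℕ × ℕ)) (hE : ∀ I ∈ E, I.1 ≤ I.2) (h : ℕ × ℕ → ℤ) :
    ∃ τ : ℕ × ℕ → ℤ, ∀ I ∈ E, ∑ J ∈ E with J.1 ≤ I.1 ∧ I.2 ≤ J.2, τ J = h I := by
  induction E using Finset.induction_on_min_value fun I : ℕ × ℕ => I.2 - I.1 with
  | empty => simp
  | insert I E hI hmin ih =>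
    obtain ⟨τ, hτ⟩ := ih fun J hJ => hE J (Finset.mem_insert_of_mem hJ)
    refine ⟨Function.update τ I (h I - ∑ J ∈ E with J.1 ≤ I.1 ∧ I.2 ≤ J.2, τ J), fun K hK => ?_⟩
    have hcongr : ∀ K : ℕ × ℕ, ∑ J ∈ E with J.1 ≤ K.1 ∧ K.2 ≤ J.2,
        Function.update τ I (h I - ∑ J ∈ E with J.1 ≤ I.1 ∧ I.2 ≤ J.2, τ J) J =
        ∑ J ∈ E with J.1 ≤ K.1 ∧ K.2 ≤ J.2, τ J := fun K => by
      refine Finset.sum_congr rfl fun J hJ => Function.update_of_ne ?_ _ _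
      rintro rfl
      exact hI (Finset.mem_filter.1 hJ).1
    rw [Finset.filter_insert]
    rcases Finset.mem_insert.1 hK with rfl | hK'
    · rw [if_pos ⟨le_rfl, le_rfl⟩, Finset.sum_insert (by simp [hI]), hcongr, Function.update_self,
        sub_add_cancel]
    · rw [if_neg, hcongr, hτ K hK']
      rintro ⟨h1, h2⟩
      have h3 := hmin K hK'
      have h4 := hE I (Finset.mem_insert_self _ _)
      have h5 := hE K hK
      exact hI ((show I = K by ext <;> omega) ▸ hK')

/-- The members of E containing the root of I are exactly those containing I, so evaluating at roots
gives the triangular system. Integrality of the solution yields unimodularity. -/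
theorem exists_forall_sum_eq (f : ℕ → ℤ) : ∃ τ : ℕ × ℕ → ℤ, ∀ k, 1 ≤ k → k ≤ g →
    ∑ J ∈ E, (if J.1 ≤ k ∧ k ≤ J.2 then τ J else 0) = f k := by
  choose! r hr using fun I (hI : I ∈ E) => hE.exists_isTubeRoot_of_mem hI
  obtain ⟨τ, hτ⟩ := exists_sum_eq E (fun I hI => (hE.bounds I hI).2.1) fun I => f (r I)
  refine ⟨τ, fun k h1 hk => ?_⟩
  obtain ⟨I, hI, hIk⟩ := hE.exists_mem_isTubeRoot h1 hk
  rw [← hE.isTubeRoot_unique hI (hr I hI) hIk, ← hτ I hI, Finset.sum_filter]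
  refine Finset.sum_congr rfl fun J hJ => if_congr ⟨(hr I hI).2 J hJ, fun h => ?_⟩ rfl rfl
  have := (hr I hI).1
  omega

end IsMaximalTubing

/-- The negatives of the directions of the tubes `J j`, as columns of a matrix. -/
def tubeMatrix {m : ℕ} (J : Fin m → ℕ × ℕ) : Matrix (Fin m) (Fin m) ℤ := fun i j =>
  (if (J j).1 ≤ 1 ∧ 1 ≤ (J j).2 then 1 else 0) -
    if (J j).1 ≤ i + 2 ∧ i + 2 ≤ (J j).2 then 1 else 0

theorem isMaximalTubing_insert {g : ℕ} (hg : 1 ≤ g) {D : Finset (Tube g)}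
    (hD : IsMaximalCompatible (fun d e : Tube g => TubeCrosses d.1 e.1) D) :
    IsMaximalTubing g (insert (1, g) (D.map (Function.Embedding.subtype _))) := by
  have htop : ∀ I : ℕ × ℕ, 1 ≤ I.1 → I.2 ≤ g → ¬ TubeCrosses I (1, g) ∧ ¬ TubeCrosses (1, g) I :=
    fun I h1 h2 => by
      simp only [TubeCrosses]
      omega
  have hmem : ∀ I : ℕ × ℕ, I ∈ insert (1, g) (D.map (Function.Embedding.subtype _)) ↔
      I = (1, g) ∨ ∃ d ∈ D, d.1 = I := fun I => by simp
  refine ⟨fun I hI => ?_, by simp, fun I hI J hJ => ?_, fun I h1 h2 h3 h => ?_⟩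
  · rcases (hmem I).1 hI with rfl | ⟨d, -, rfl⟩
    · simpa using hg
    · have := mem_tubes.1 d.2
      omega
  · rcases (hmem I).1 hI with rfl | ⟨d, hd, rfl⟩ <;> rcases (hmem J).1 hJ with rfl | ⟨e, he, rfl⟩
    · exact (htop _ le_rfl le_rfl).1
    · exact (htop _ (mem_tubes.1 e.2).1 (mem_tubes.1 e.2).2.2.1).2
    · exact (htop _ (mem_tubes.1 d.2).1 (mem_tubes.1 d.2).2.2.1).1
    · exact hD.1 d hd e he
  · rw [hmem]
    by_cases hI : I = (1, g)
    · exact Or.inl hI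
    · have hI' : I ∈ tubes g := mem_tubes.2 ⟨h1, h2, h3, fun h => hI (Prod.ext h.1 h.2)⟩
      exact Or.inr ⟨⟨I, hI'⟩, hD.2 _ fun e he => h e.1 ((hmem _).2 (Or.inr ⟨e, he, rfl⟩)), rfl⟩

theorem card_of_isMaximalCompatible {m : ℕ} {D : Finset (Tube (m + 1))}
    (hD : IsMaximalCompatible (fun d e : Tube (m + 1) => TubeCrosses d.1 e.1) D) : D.card = m := by
  have h := (isMaximalTubing_insert (by omega) hD).card_eq
  rw [Finset.card_insert_of_notMem, Finset.card_map] at h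
  · omega
  · simp [mem_tubes]

/-- The tubes of a maximal tubing form a basis of the lattice. -/
theorem abs_det_tubeMatrix {m : ℕ} {D : Finset (Tube (m + 1))}
    (hD : IsMaximalCompatible (fun d e : Tube (m + 1) => TubeCrosses d.1 e.1) D)
    (e : Fin m ≃ D) :
    |((tubeMatrix fun j => (e j).1.1).map ((↑) : ℤ → ℝ)).det| = 1 := by
  -- Surjectivity over ℤ makes the determinant a unit. Prescribing the value 0 at k = 1 eliminates
  -- the coefficient of the full interval.
  have hsurj : Function.Surjective (tubeMatrix fun j => (e j).1.1).mulVec := fun f => by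
    obtain ⟨τ, hτ⟩ := (isMaximalTubing_insert (by omega) hD).exists_forall_sum_eq
      fun k => if h : 2 ≤ k ∧ k < m + 2 then -f ⟨k - 2, by omega⟩ else 0
    have hsum : ∀ k, 1 ≤ k → k ≤ m + 1 → τ (1, m + 1) +
        ∑ j, (if (e j).1.1.1 ≤ k ∧ k ≤ (e j).1.1.2 then τ (e j).1.1 else 0) =
        if h : 2 ≤ k ∧ k < m + 2 then -f ⟨k - 2, by omega⟩ else 0 := fun k h1 hk => by
      rw [← hτ k h1 hk, Finset.sum_insert (by simp [mem_tubes]), if_pos ⟨h1, hk⟩, Finset.sum_map,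
        ← Finset.sum_coe_sort D, ← e.sum_comp]
      rfl
    refine ⟨fun j => τ (e j).1.1, funext fun i => ?_⟩
    have h1 := hsum 1 le_rfl (by omega)
    have h2 := hsum (i + 2) (by omega) (by omega)
    simp only [Nat.add_sub_cancel, Fin.eta] at h2
    rw [dif_neg (by omega)] at h1
    rw [dif_pos (by omega)] at h2
    simp only [Matrix.mulVec, dotProduct, tubeMatrix, sub_mul, ite_mul, one_mul, zero_mul,
      Finset.sum_sub_distrib]
    linarith
  have hunit := (Matrix.isUnit_iff_isUnit_det _).1 (Matrix.mulVec_surjective_iff_isUnit.1 hsurj)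
  have hdet : ((tubeMatrix fun j => (e j).1.1).map ((↑) : ℤ → ℝ)).det =
      ((tubeMatrix fun j => (e j).1.1).det : ℝ) := ((Int.castRingHom ℝ).map_det _).symm
  rw [hdet]
  rcases Int.isUnit_iff.1 hunit with h | h <;> simp [h]

/-! ### Tropical limits of the interval coordinates. -/

/-- The sum lies between its largest term and its number of terms times that term; the logarithm of
this number is killed by ε. -/
theorem tendsto_mul_log_sum_exp {s : Finset ℕ} {T : ℕ → ℝ} {M : ℝ} (hM : ∃ k ∈ s, T k = M)
    (hle : ∀ k ∈ s, T k ≤ M) :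
    Tendsto (fun ε : ℝ => ε * Real.log (∑ k ∈ s, Real.exp (ε⁻¹ * T k))) (𝓝[>] 0) (𝓝 M) := by
  obtain ⟨k₀, hk₀, rfl⟩ := hM
  have hcard : (0 : ℝ) < s.card := by exact_mod_cast Finset.card_pos.2 ⟨k₀, hk₀⟩
  have hup : Tendsto (fun ε : ℝ => ε * Real.log s.card + T k₀) (𝓝[>] 0) (𝓝 (T k₀)) := by
    have : Continuous fun ε : ℝ => ε * Real.log s.card + T k₀ := by fun_prop
    simpa using (this.tendsto 0).mono_left (nhdsWithin_le_nhds (s := Ioi 0))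
  refine tendsto_of_tendsto_of_tendsto_of_le_of_le' tendsto_const_nhds hup ?_ ?_
  · filter_upwards [self_mem_nhdsWithin] with ε hε
    have hε : 0 < ε := hε
    have h1 : Real.exp (ε⁻¹ * T k₀) ≤ ∑ k ∈ s, Real.exp (ε⁻¹ * T k) :=
      Finset.single_le_sum (f := fun k => Real.exp (ε⁻¹ * T k)) (fun _ _ => (Real.exp_pos _).le) hk₀
    have h2 := Real.log_le_log (Real.exp_pos _) h1
    rw [Real.log_exp] at h2
    calc T k₀ = ε * (ε⁻¹ * T k₀) := by field_simp
      _ ≤ _ := by gcongr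
  · filter_upwards [self_mem_nhdsWithin] with ε hε
    have hε : 0 < ε := hε
    have h1 : ∑ k ∈ s, Real.exp (ε⁻¹ * T k) ≤ s.card * Real.exp (ε⁻¹ * T k₀) := by
      rw [← nsmul_eq_mul]
      refine Finset.sum_le_card_nsmul _ _ _ fun k hk => ?_
      have := hle k hk
      gcongr
    have h2 := Real.log_le_log (Finset.sum_pos (fun k _ => Real.exp_pos _) ⟨k₀, hk₀⟩) h1
    rw [Real.log_mul hcard.ne' (Real.exp_pos _).ne', Real.log_exp] at h2
    calc _ ≤ ε * (Real.log s.card + ε⁻¹ * T k₀) := by gcongr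
      _ = _ := by field_simp

theorem tendsto_zero_of_tendsto_mul_log {f : ℝ → ℝ} (hf : ∀ ε, 0 < f ε) {L : ℝ} (hL : L < 0)
    (h : Tendsto (fun ε : ℝ => ε * Real.log (f ε)) (𝓝[>] 0) (𝓝 L)) :
    Tendsto f (𝓝[>] 0) (𝓝 0) := by
  have h1 : Tendsto (fun ε : ℝ => Real.log (f ε)) (𝓝[>] 0) atBot := by
    refine (h.neg_mul_atTop hL tendsto_inv_nhdsGT_zero).congr' ?_
    filter_upwards [self_mem_nhdsWithin] with ε hε
    have : ε ≠ 0 := (show 0 < ε from hε).ne'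
    field_simp
  refine (Real.tendsto_exp_atBot.comp h1).congr fun ε => ?_
  simp [Real.exp_log (hf ε)]

section Tropical

variable {g : ℕ} {T : ℕ → ℝ}

theorem exists_tendsto_mul_log_gapSum (T : ℕ → ℝ) {p q : ℕ} (hpq : p ≤ q) :
    ∃ P, Tendsto (fun ε : ℝ => ε * Real.log (gapSum g (fun k => Real.exp (ε⁻¹ * T k)) p q))
      (𝓝[>] 0) (𝓝 P) := by
  unfold gapSum
  split_ifs with h
  · exact ⟨0, by simp⟩
  · obtain ⟨k, hk, hmax⟩ := Finset.exists_max_image (Finset.Icc p q) T ⟨p, by simpa using hpq⟩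
    exact ⟨T k, tendsto_mul_log_sum_exp ⟨k, hk, rfl⟩ hmax⟩

theorem tendsto_mul_log_tubeU {I : ℕ × ℕ} (hI : I.1 ≤ I.2) {P : ℕ → ℕ → ℝ}
    (hP : ∀ p q, p ≤ q → q ≤ I.2 + 1 → Tendsto (fun ε : ℝ =>
      ε * Real.log (gapSum g (fun k => Real.exp (ε⁻¹ * T k)) p q)) (𝓝[>] 0) (𝓝 (P p q))) :
    Tendsto (fun ε : ℝ => ε * Real.log (tubeU g (fun k => Real.exp (ε⁻¹ * T k)) I)) (𝓝[>] 0)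
      (𝓝 (P I.1 I.2 + P (I.1 - 1) (I.2 + 1) - P (I.1 - 1) I.2 - P I.1 (I.2 + 1))) := by
  refine ((((hP I.1 I.2 hI (by omega)).add (hP (I.1 - 1) (I.2 + 1) (by omega) (by omega))).sub
    (hP (I.1 - 1) I.2 (by omega) (by omega))).sub
      (hP I.1 (I.2 + 1) (by omega) (by omega))).congr fun ε => ?_
  have hpos : ∀ {p q}, p ≤ q → gapSum g (fun k => Real.exp (ε⁻¹ * T k)) p q ≠ 0 := fun h =>
    (gapSum_pos (fun _ => Real.exp_pos _) h).ne'
  rw [tubeU, Real.log_div (mul_ne_zero (hpos hI) (hpos (by omega)))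
    (mul_ne_zero (hpos (by omega)) (hpos (by omega))),
    Real.log_mul (hpos hI) (hpos (by omega)), Real.log_mul (hpos (by omega)) (hpos (by omega))]
  ring

end Tropical

/-- The logarithmic gaps of the point `∑ j, τ j • (-dir (J j))`, up to a common shift. -/
def tubeCombination {m : ℕ} (J : Fin m → ℕ × ℕ) (τ : Fin m → ℝ) (k : ℕ) : ℝ :=
  -∑ j, if (J j).1 ≤ k ∧ k ≤ (J j).2 then τ j else 0

section

variable {m : ℕ}

theorem logGap_tubeMatrix_mulVec (J : Fin m → ℕ × ℕ) (τ : Fin m → ℝ) {k : ℕ} (h1 : 1 ≤ k)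
    (hk : k ≤ m + 1) :
    logGap (((tubeMatrix J).map ((↑) : ℤ → ℝ)).mulVec τ) k =
      tubeCombination J τ k - tubeCombination J τ 1 := by
  obtain rfl | h : k = 1 ∨ 2 ≤ k := by omega
  · simp [logGap]
  · rw [logGap, dif_pos ⟨h, by omega⟩]
    simp only [Matrix.mulVec, dotProduct, tubeMatrix, Matrix.map_apply, Nat.sub_add_cancel h,
      tubeCombination]
    push_cast
    simp only [sub_mul, ite_mul, one_mul, zero_mul, Finset.sum_sub_distrib]
    ring

theorem tubeU_expGap_smul_mulVec (J : Fin m → ℕ × ℕ) (τ : Fin m → ℝ) (s : ℝ) (d : Tube (m + 1)) :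
    tubeU (m + 1) (expGap (s • ((tubeMatrix J).map ((↑) : ℤ → ℝ)).mulVec τ)) d.1 =
      tubeU (m + 1) (fun k => Real.exp (s * tubeCombination J τ k)) d.1 := by
  refine tubeU_scale (c := Real.exp (-(s * tubeCombination J τ 1))) (Real.exp_pos _).ne'
    (fun k h1 hk => ?_) d
  have h := logGap_add_smul 0 (((tubeMatrix J).map ((↑) : ℤ → ℝ)).mulVec τ) s k
  have h0 : logGap (0 : Fin m → ℝ) k = 0 := by simp [logGap]
  rw [zero_add, h0, zero_add] at h
  rw [expGap, h, logGap_tubeMatrix_mulVec J τ h1 hk, ← Real.exp_add]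
  congr 1
  ring

variable {D : Finset (Tube (m + 1))}
  (hD : IsMaximalCompatible (fun d e : Tube (m + 1) => TubeCrosses d.1 e.1) D) (e : Fin m ≃ D)
include hD

/-- The tropical sum is the maximum over k in [p, q] of minus the total weight of the tubes
containing k. It is attained at the root from `exists_isTubeRoot_between`: there only tubes
containing all of [p, q] contribute, and all weights are positive. -/
theorem tendsto_mul_log_gapSum_of_pos {τ : Fin m → ℝ} (hτ : ∀ j, 0 < τ j) {p q : ℕ} (hpq : p ≤ q)
    (hq : q ≤ m + 2) :
    Tendsto (fun ε : ℝ => ε * Real.log (gapSum (m + 1)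
      (fun k => Real.exp (ε⁻¹ * tubeCombination (fun j => (e j).1.1) τ k)) p q)) (𝓝[>] 0)
      (𝓝 (-∑ j, if (e j).1.1.1 ≤ p ∧ q ≤ (e j).1.1.2 then τ j else 0)) := by
  by_cases h : p = 0 ∨ q = m + 1 + 1
  · have h0 : ∑ j, (if (e j).1.1.1 ≤ p ∧ q ≤ (e j).1.1.2 then τ j else 0) = 0 :=
      Finset.sum_eq_zero fun j _ => if_neg (by have := mem_tubes.1 (e j).1.2; omega)
    simp only [gapSum, if_pos h, h0]
    simp
  · simp only [gapSum, if_neg h]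
    have hE := isMaximalTubing_insert (by omega) hD
    have hmem : ∀ j, (e j).1.1 ∈ insert (1, m + 1) (D.map (Function.Embedding.subtype _)) :=
      fun j => by simp
    obtain ⟨I, hI, k, hk, hpk, hkq, hIp, hIq⟩ :=
      hE.exists_isTubeRoot_between (p := p) (q := q) (by omega) hpq (by omega)
    refine tendsto_mul_log_sum_exp ⟨k, by simp [hpk, hkq], ?_⟩ fun l hl => ?_
    · simp only [tubeCombination]
      congr 1
      refine Finset.sum_congr rfl fun j _ => if_congr ⟨fun h => ?_, fun h => ?_⟩ rfl rfl
      · have := hk.2 _ (hmem j) h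
        omega
      · omega
    · have hl := Finset.mem_Icc.1 hl
      refine neg_le_neg (Finset.sum_le_sum fun j _ => ?_)
      have := hτ j
      beta_reduce
      split_ifs <;> first | omega | linarith

/-- The mixed second difference of the indicators again isolates the weight of d itself. -/
theorem tendsto_mul_log_tubeU_of_pos {τ : Fin m → ℝ} (hτ : ∀ j, 0 < τ j) (d : Tube (m + 1)) :
    Tendsto (fun ε : ℝ => ε * Real.log (tubeU (m + 1)
      (expGap (ε⁻¹ • ((tubeMatrix fun j => (e j).1.1).map ((↑) : ℤ → ℝ)).mulVec τ)) d.1)) (𝓝[>] 0)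
      (𝓝 (-∑ j, if (e j).1 = d then τ j else 0)) := by
  simp only [tubeU_expGap_smul_mulVec]
  have hd := mem_tubes.1 d.2
  have h := tendsto_mul_log_tubeU hd.2.1 fun p q hpq (hq : q ≤ d.1.2 + 1) =>
    tendsto_mul_log_gapSum_of_pos hD e hτ hpq (by omega)
  convert h using 2
  simp only [← Finset.sum_neg_distrib, ← Finset.sum_add_distrib, ← Finset.sum_sub_distrib]
  refine Finset.sum_congr rfl fun j _ => ?_
  have hj : (e j).1 = d ↔ (e j).1.1.1 = d.1.1 ∧ (e j).1.1.2 = d.1.2 := by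
    rw [Subtype.ext_iff, Prod.ext_iff]
  simp only [hj]
  split_ifs <;> first | omega | simp

/-- By maximality d crosses some f in D. Since u_f tends to 0, the u-equation of f gives u_d ≥ 1 -
u_f, which tends to 1. -/
theorem tendsto_tubeU_of_notMem {τ : Fin m → ℝ} (hτ : ∀ j, 0 < τ j) {d : Tube (m + 1)}
    (hd : d ∉ D) :
    Tendsto (fun ε : ℝ => tubeU (m + 1)
      (expGap (ε⁻¹ • ((tubeMatrix fun j => (e j).1.1).map ((↑) : ℤ → ℝ)).mulVec τ)) d.1) (𝓝[>] 0)
      (𝓝 1) := by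
  obtain ⟨f, hf, hdf⟩ : ∃ f ∈ D, TubeCrosses d.1 f.1 := by
    by_contra! h
    exact hd (hD.2 d h)
  have hlog := tendsto_mul_log_tubeU_of_pos hD e hτ f
  rw [Finset.sum_eq_single (e.symm ⟨f, hf⟩) (fun j _ hj => if_neg fun h => hj (by
    rw [Equiv.eq_symm_apply, Subtype.ext_iff, h])) (by simp), if_pos (by simp)] at hlog
  have h0 := tendsto_zero_of_tendsto_mul_log
    (fun ε => tubeU_pos (expGap_pos _) (mem_tubes.1 f.2).2.1)
    (neg_neg_of_pos (hτ (e.symm ⟨f, hf⟩))) hlog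
  refine tendsto_of_tendsto_of_tendsto_of_le_of_le (by simpa using h0.const_sub 1)
    tendsto_const_nhds (fun ε => ?_) fun ε => tubeU_le_one (expGap_pos _) d
  have hmem : d ∈ Finset.univ.filter fun d : Tube (m + 1) => TubeCrosses f.1 d.1 := by
    rw [Finset.mem_filter_univ]
    simp only [TubeCrosses] at hdf ⊢
    omega
  have h1 := tubeU_add_prod_crosses (expGap_pos
    (ε⁻¹ • ((tubeMatrix fun j => (e j).1.1).map ((↑) : ℤ → ℝ)).mulVec τ)) f
  rw [← Finset.mul_prod_erase _ _ hmem] at h1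
  have h2 : tubeU (m + 1) (expGap
      (ε⁻¹ • ((tubeMatrix fun j => (e j).1.1).map ((↑) : ℤ → ℝ)).mulVec τ)) d.1 *
      ∏ x ∈ (Finset.univ.filter fun d : Tube (m + 1) => TubeCrosses f.1 d.1).erase d,
        tubeU (m + 1) (expGap
          (ε⁻¹ • ((tubeMatrix fun j => (e j).1.1).map ((↑) : ℤ → ℝ)).mulVec τ)) x.1 ≤
      tubeU (m + 1) (expGap
        (ε⁻¹ • ((tubeMatrix fun j => (e j).1.1).map ((↑) : ℤ → ℝ)).mulVec τ)) d.1 :=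
    mul_le_of_le_one_right (tubeU_pos (expGap_pos _) (mem_tubes.1 d.2).2.1).le
      (Finset.prod_le_one (fun x _ => (tubeU_pos (expGap_pos _) (mem_tubes.1 x.2).2.1).le)
        fun x _ => tubeU_le_one (expGap_pos _) x)
  beta_reduce
  linarith

/-- The tropical limits α_d of ε log u_d are nonpositive. If they all vanished outside D, the
direction would be a combination of the tubes of D with weights -α_d ≥ 0, and invertibility of the
matrix would force τ_j = -α_j ≥ 0 for all j. -/
theorem exists_tendsto_tubeU_zero {τ : Fin m → ℝ} (hτ : ∃ j, τ j < 0) :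
    ∃ d ∉ D, Tendsto (fun ε : ℝ => tubeU (m + 1)
      (expGap (ε⁻¹ • ((tubeMatrix fun j => (e j).1.1).map ((↑) : ℤ → ℝ)).mulVec τ)) d.1) (𝓝[>] 0)
      (𝓝 0) := by
  set M := (tubeMatrix fun j => (e j).1.1).map ((↑) : ℤ → ℝ) with hM
  set T := tubeCombination (fun j => (e j).1.1) τ with hT
  choose! P hP using fun p q (hpq : p ≤ q) => exists_tendsto_mul_log_gapSum (g := m + 1) T hpq
  set α : Tube (m + 1) → ℝ := fun d => P d.1.1 d.1.2 + P (d.1.1 - 1) (d.1.2 + 1) -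
    P (d.1.1 - 1) d.1.2 - P d.1.1 (d.1.2 + 1)
  have hα : ∀ d : Tube (m + 1), Tendsto (fun ε : ℝ => ε * Real.log (tubeU (m + 1)
      (fun k => Real.exp (ε⁻¹ * T k)) d.1)) (𝓝[>] 0) (𝓝 (α d)) := fun d =>
    tendsto_mul_log_tubeU (mem_tubes.1 d.2).2.1 fun p q hpq _ => hP p q hpq
  have hα0 : ∀ d, α d ≤ 0 := fun d => by
    refine le_of_tendsto (hα d) ?_
    filter_upwards [self_mem_nhdsWithin] with ε hε
    exact mul_nonpos_of_nonneg_of_nonpos (le_of_lt hε)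
      (Real.log_nonpos (tubeU_pos (fun _ => Real.exp_pos _) (mem_tubes.1 d.2).2.1).le
        (tubeU_le_one (fun _ => Real.exp_pos _) d))
  by_cases h : ∃ d ∉ D, α d < 0
  · obtain ⟨d, hd, hd0⟩ := h
    refine ⟨d, hd, ?_⟩
    simp only [hM, tubeU_expGap_smul_mulVec]
    exact tendsto_zero_of_tendsto_mul_log
      (fun ε => tubeU_pos (fun _ => Real.exp_pos _) (mem_tubes.1 d.2).2.1) hd0 (hα d)
  · push Not at h
    exfalso
    have hsum : ∀ k, 1 ≤ k → k ≤ m + 1 →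
        T k = P 1 (m + 1) + ∑ j, if (e j).1.1.1 ≤ k ∧ k ≤ (e j).1.1.2 then α (e j).1 else 0 :=
      fun k h1 hk => by
      -- The tropical form of y_k = gap[1, g] · ∏ u_e over the tubes e containing k.
      have h2 : T k = P 1 (m + 1) +
          ∑ d : Tube (m + 1), if d.1.1 ≤ k ∧ k ≤ d.1.2 then α d else 0 := by
        have h3 : Tendsto (fun ε : ℝ => ε * Real.log (gapSum (m + 1)
            (fun k => Real.exp (ε⁻¹ * T k)) 1 (m + 1)) + ∑ d : Tube (m + 1),
              if d.1.1 ≤ k ∧ k ≤ d.1.2 then ε * Real.log (tubeU (m + 1)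
                (fun k => Real.exp (ε⁻¹ * T k)) d.1) else 0) (𝓝[>] 0) (𝓝 (P 1 (m + 1) +
          ∑ d : Tube (m + 1), if d.1.1 ≤ k ∧ k ≤ d.1.2 then α d else 0)) := by
          refine (hP 1 (m + 1) (by omega)).add (tendsto_finsetSum _ fun d _ => ?_)
          split_ifs
          · exact hα d
          · exact tendsto_const_nhds
        refine tendsto_nhds_unique (tendsto_const_nhds.congr' ?_) h3
        filter_upwards [self_mem_nhdsWithin] with ε hε
        have hε : ε ≠ 0 := (show 0 < ε from hε).ne'
        have hy : ∀ k, 0 < Real.exp (ε⁻¹ * T k) := fun k => Real.exp_pos _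
        have h4 := gapSum_eq_mul_prod hy h1 le_rfl hk
        have hne : ∀ d ∈ (Finset.univ : Finset (Tube (m + 1))),
            (if d.1.1 ≤ k ∧ k ≤ d.1.2 then
              tubeU (m + 1) (fun k => Real.exp (ε⁻¹ * T k)) d.1 else 1) ≠ 0 := fun d _ => by
          have := tubeU_pos (g := m + 1) hy (mem_tubes.1 d.2).2.1
          split_ifs <;> positivity
        have h5 := congrArg Real.log h4
        rw [gapSum_self h1 hk, Real.log_exp, Real.log_mul (gapSum_pos hy (by omega)).ne'
          (Finset.prod_ne_zero_iff.2 hne), Real.log_prod hne] at h5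
        calc T k = ε * (ε⁻¹ * T k) := by field_simp
          _ = _ := by
            rw [h5, mul_add, Finset.mul_sum]
            congr 1
            refine Finset.sum_congr rfl fun d _ => ?_
            split_ifs <;> simp
      rw [h2]
      congr 1
      have h3 : ∀ d ∉ D, (if d.1.1 ≤ k ∧ k ≤ d.1.2 then α d else 0) = 0 := fun d hd => by
        rw [le_antisymm (hα0 d) (h d hd), ite_self]
      rw [← Finset.sum_subset (Finset.subset_univ D) fun d _ hd => h3 d hd,
        ← Finset.sum_coe_sort D, ← e.sum_comp]
    have hker : M.mulVec (τ + fun j => α (e j).1) = 0 := by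
      funext i
      have h1 := hsum 1 le_rfl (by omega)
      have h2 := hsum (i + 2) (by omega) (by omega)
      simp only [hT, tubeCombination] at h1 h2
      simp only [hM, Matrix.mulVec, dotProduct, tubeMatrix, Matrix.map_apply, Pi.add_apply,
        Pi.zero_apply]
      push_cast
      simp only [sub_mul, mul_add, ite_mul, one_mul, zero_mul, Finset.sum_sub_distrib,
        Finset.sum_add_distrib]
      linarith
    have hdet : M.det ≠ 0 := fun h0 => by
      have := abs_det_tubeMatrix hD e
      rw [← hM, h0] at this
      simp at this
    have hzero := Matrix.eq_zero_of_mulVec_eq_zero hdet hker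
    obtain ⟨j, hj⟩ := hτ
    have := congrFun hzero j
    simp only [Pi.add_apply, Pi.zero_apply] at this
    linarith [hα0 (e j).1]

end

/-! ### The leading coefficient of a maximal tubing. -/

section

variable {m : ℕ} {D : Finset (Tube (m + 1))}
  (hD : IsMaximalCompatible (fun d e : Tube (m + 1) => TubeCrosses d.1 e.1) D) (e : Fin m ≃ D)
include hD

theorem measurePreserving_tubeMatrix :
    MeasurePreserving (Matrix.toLin' ((tubeMatrix fun j => (e j).1.1).map ((↑) : ℤ → ℝ))) := by
  have h := abs_det_tubeMatrix hD e
  refine ⟨(LinearMap.continuous_of_finiteDimensional _).measurable, ?_⟩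
  rw [Real.map_matrix_volume_pi_eq_smul_volume_pi (fun h0 => by simp [h0] at h), abs_inv, h]
  simp

/-- The powers u_d^ε give exp(-τ) for d in D and 1 otherwise; the fixed powers u_d^{a_d} tend to 1,
because a_d vanishes on D and u_d tends to 1 off D. -/
theorem tendsto_monomial_of_pos {τ : Fin m → ℝ} (hτ : ∀ j, 0 < τ j) {a : Tube (m + 1) → ℕ}
    (ha : ∀ d, a d = 0 ↔ d ∈ D) :
    Tendsto (fun ε : ℝ => (tubeChart m).monomial (fun d => ε + a d)
      (ε⁻¹ • ((tubeMatrix fun j => (e j).1.1).map ((↑) : ℤ → ℝ)).mulVec τ)) (𝓝[>] 0)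
      (𝓝 (∏ j, Complex.exp (-(τ j : ℂ)))) := by
  simp only [DihedralChart.monomial_eq_exp]
  rw [← Complex.exp_sum]
  refine (Complex.continuous_exp.tendsto _).comp ?_
  have hsum : ∑ j, -(τ j : ℂ) = ∑ d : Tube (m + 1),
      ((-∑ j, if (e j).1 = d then τ j else 0 : ℝ) : ℂ) := by
    have h : ∑ j, -τ j = ∑ d : Tube (m + 1), -∑ j, if (e j).1 = d then τ j else 0 := by
      rw [Finset.sum_neg_distrib, Finset.sum_neg_distrib, Finset.sum_comm]
      simp only [Finset.sum_ite_eq, Finset.mem_univ, if_true]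
    exact_mod_cast congrArg Complex.ofReal h
  rw [hsum]
  refine tendsto_finsetSum _ fun d _ => ?_
  have h1 := tendsto_mul_log_tubeU_of_pos hD e hτ d
  have h2 : Tendsto (fun ε : ℝ => a d * Real.log (tubeU (m + 1)
      (expGap (ε⁻¹ • ((tubeMatrix fun j => (e j).1.1).map ((↑) : ℤ → ℝ)).mulVec τ)) d.1)) (𝓝[>] 0)
      (𝓝 0) := by
    by_cases hd : d ∈ D
    · simp [(ha d).2 hd]
    · simpa using ((tendsto_tubeU_of_notMem hD e hτ hd).log one_ne_zero).const_mul (a d : ℝ)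
  have h3 := (Complex.continuous_ofReal.tendsto _).comp (h1.add h2)
  rw [add_zero] at h3
  refine h3.congr fun ε => ?_
  simp only [tubeChart, Function.comp]
  push_cast
  ring

/-- Some u_d with d outside D tends to 0 and carries an exponent of at least 1, while all other
factors are at most 1. -/
theorem tendsto_monomial_of_neg {τ : Fin m → ℝ} (hτ : ∃ j, τ j < 0) {a : Tube (m + 1) → ℕ}
    (ha : ∀ d, a d = 0 ↔ d ∈ D) :
    Tendsto (fun ε : ℝ => (tubeChart m).monomial (fun d => ε + a d)
      (ε⁻¹ • ((tubeMatrix fun j => (e j).1.1).map ((↑) : ℤ → ℝ)).mulVec τ)) (𝓝[>] 0) (𝓝 0) := by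
  obtain ⟨d, hd, h⟩ := exists_tendsto_tubeU_zero hD e hτ
  refine squeeze_zero_norm' ?_ h
  filter_upwards [self_mem_nhdsWithin] with ε hε
  have hε : 0 < ε := hε
  have had : (1 : ℝ) ≤ a d := by exact_mod_cast Nat.one_le_iff_ne_zero.2 fun h => hd ((ha d).1 h)
  rw [DihedralChart.norm_monomial, ← Finset.mul_prod_erase _ _ (Finset.mem_univ d)]
  set t := ε⁻¹ • ((tubeMatrix fun j => (e j).1.1).map ((↑) : ℤ → ℝ)).mulVec τ
  have hpow : ∀ x : Tube (m + 1), 0 ≤ ((ε : ℂ) + a x).re := fun x => by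
    simp
    positivity
  calc _ ≤ (tubeChart m).u d t ^ ((ε : ℂ) + a d).re :=
        mul_le_of_le_one_right (Real.rpow_nonneg ((tubeChart m).pos d t).le _)
          (Finset.prod_le_one (fun x _ => Real.rpow_nonneg ((tubeChart m).pos x t).le _)
            fun x _ => Real.rpow_le_one ((tubeChart m).pos x t).le ((tubeChart m).le_one x t)
              (hpow x))
    _ ≤ (tubeChart m).u d t ^ (1 : ℝ) :=
        Real.rpow_le_rpow_of_exponent_ge ((tubeChart m).pos d t) ((tubeChart m).le_one d t)
          (by simp; linarith)
    _ = _ := Real.rpow_one _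

theorem tendsto_pow_mul_integral_tubeChart {a : Tube (m + 1) → ℕ} (ha : ∀ d, a d = 0 ↔ d ∈ D) :
    Tendsto (fun ε : ℝ => (ε : ℂ) ^ m * (tubeChart m).integral fun d => ε + a d) (𝓝[>] 0)
      (𝓝 1) := by
  have hcard := card_of_isMaximalCompatible hD
  have e : Fin m ≃ D := (finCongr hcard.symm).trans D.equivFin.symm
  set M := (tubeMatrix fun j => (e j).1.1).map ((↑) : ℤ → ℝ) with hM
  have hmp : MeasurePreserving (Matrix.toLin' M) := measurePreserving_tubeMatrix hD e
  have hlim : ∫ τ : Fin m → ℝ, ∏ j, (Ioi (0 : ℝ)).indicator (fun x => Complex.exp (-(x : ℂ))) (τ j)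
      = 1 := by
    rw [integral_fintype_prod_volume_eq_prod
      (fun _ : Fin m => (Ioi (0 : ℝ)).indicator (fun x => Complex.exp (-(x : ℂ))))]
    refine Finset.prod_eq_one fun j _ => ?_
    rw [integral_indicator measurableSet_Ioi]
    have := integral_exp_neg_Ioi_zero
    rw [← Complex.ofReal_inj, ← integral_complex_ofReal] at this
    simpa using this
  rw [← hlim]
  -- In the substitution t = ε⁻¹ M τ the matrix M preserves volume, so the Jacobian is just the
  -- power of ε.
  have heq : ∀ᶠ ε : ℝ in 𝓝[>] 0, ∫ τ, (tubeChart m).monomial (fun d => ε + a d)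
      (ε⁻¹ • M.mulVec τ) = (ε : ℂ) ^ m * (tubeChart m).integral fun d => ε + a d := by
    filter_upwards [self_mem_nhdsWithin] with ε hε
    have hε : 0 < ε := hε
    have h1 : ∫ τ, (tubeChart m).monomial (fun d => ε + a d) (ε⁻¹ • M.mulVec τ) =
        ∫ t, (tubeChart m).monomial (fun d => ε + a d) (ε⁻¹ • t) := by
      have hc := ((tubeChart m).continuous_monomial fun d => ε + a d).comp
        (continuous_const_smul (ε⁻¹ : ℝ))
      conv_rhs => rw [← hmp.map_eq]
      rw [integral_map hmp.measurable.aemeasurable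
        (hmp.map_eq ▸ hc.aestronglyMeasurable)]
      simp [Matrix.toLin'_apply]
    rw [h1, Measure.integral_comp_inv_smul_of_nonneg _ _ hε.le, DihedralChart.integral]
    simp
  refine Tendsto.congr' heq ?_
  -- Decay with exponent ε at the point ε⁻¹ M τ gives a bound in which ε cancels.
  refine tendsto_integral_filter_of_dominated_convergence
    (fun τ => ∏ k, Real.exp (-(1 / (m + 1)) * |M.mulVec τ k|)) ?_ ?_ ?_ ?_
  · refine Eventually.of_forall fun ε => Continuous.aestronglyMeasurable ?_
    have := (tubeChart m).continuous_monomial fun d => ε + a d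
    have h2 : Continuous fun τ : Fin m → ℝ => M.mulVec τ := by fun_prop
    exact this.comp ((continuous_const_smul (ε⁻¹ : ℝ)).comp h2)
  · filter_upwards [self_mem_nhdsWithin] with ε hε
    have hε : 0 < ε := hε
    refine ae_of_all _ fun τ => ?_
    rw [DihedralChart.norm_monomial]
    refine ((tubeChart m).prod_rpow_le_prod_rpow (a := fun _ => ε)
      (fun d => by simp) _).trans (((tubeChart m).prod_rpow_le hε.le _).trans (le_of_eq ?_))
    refine Finset.prod_congr rfl fun k _ => ?_
    rw [Pi.smul_apply, smul_eq_mul, abs_mul, abs_of_pos (inv_pos.2 hε)]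
    congr 1
    field_simp
  · have h1 : Integrable fun t : Fin m → ℝ => ∏ k, Real.exp (-(1 / ((m : ℝ) + 1)) * |t k|) :=
      DihedralChart.integrable_prod_exp_neg_mul_abs (by positivity)
    have := hmp.integrable_comp_of_integrable h1
    simpa [Function.comp_def, Matrix.toLin'_apply] using this
  · have hne : ∀ᵐ τ : Fin m → ℝ, ∀ j, τ j ≠ 0 := by
      rw [ae_all_iff]
      intro j
      simp only [ae_iff, not_not, ne_eq]
      exact Measure.pi_hyperplane (fun _ => volume) j 0
    filter_upwards [hne] with τ hτ
    by_cases hpos : ∀ j, 0 < τ j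
    · have := tendsto_monomial_of_pos hD e hpos ha
      simpa [indicator, hpos] using this
    · push Not at hpos
      obtain ⟨j, hj⟩ := hpos
      rw [Finset.prod_eq_zero (Finset.mem_univ j)
        (indicator_of_notMem (show τ j ∉ Ioi (0 : ℝ) by simpa using hj) _)]
      exact tendsto_monomial_of_neg hD e ⟨j, lt_of_le_of_ne hj (hτ j)⟩ ha

end

theorem tubeCrosses_symm {I J : ℕ × ℕ} (h : TubeCrosses I J) : TubeCrosses J I := by
  simp only [TubeCrosses] at h ⊢
  omega

theorem not_tubeCrosses_self (I : ℕ × ℕ) : ¬ TubeCrosses I I := by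
  simp [TubeCrosses]

/-- The field theory limit in terms of tubes. -/
theorem tendsto_pow_mul_continuation_tubeChart {m : ℕ}
    [DecidablePred (IsMaximalCompatible fun d e : Tube (m + 1) => TubeCrosses d.1 e.1)]
    {G : (Tube (m + 1) → ℂ) → ℂ} (hG : DifferentiableOn ℂ G {X | ∀ d, ∀ k : ℕ, X d ≠ -(k : ℂ)})
    (hGJ : ∀ X : Tube (m + 1) → ℂ, (∀ d, 0 < (X d).re) → G X = (tubeChart m).integral X)
    {X : Tube (m + 1) → ℂ} (hX : ∀ d, X d ≠ 0) :
    Tendsto (fun α : ℂ => α ^ m * G (α • X)) (𝓝[≠] 0)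
      (𝓝 (∑ D with IsMaximalCompatible (fun d e : Tube (m + 1) => TubeCrosses d.1 e.1) D,
        ∏ d ∈ D, 1 / X d)) :=
  (tubeChart m).tendsto_pow_mul_continuation (fun _ _ => tubeCrosses_symm)
    (fun _ => not_tubeCrosses_self _) (fun d t => tubeU_add_prod_crosses (expGap_pos t) d)
    (fun _ hD => card_of_isMaximalCompatible hD)
    (fun _ hD _ ha => tendsto_pow_mul_integral_tubeChart hD ha) hG hGJ hX

/-! ### Dictionary between tubes and diagonals. -/

section

variable {m : ℕ}

/-- The diagonal of the `(m + 3)`-gon that corresponds to a tube. -/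
def tubeDiagonal (I : Tube (m + 1)) : Fin (m + 3) × Fin (m + 3) :=
  if I.1.1 = 1 then (⟨I.1.2, by have := mem_tubes.1 I.2; omega⟩, ⟨m + 2, by omega⟩)
  else (⟨I.1.1 - 2, by have := mem_tubes.1 I.2; omega⟩,
    ⟨I.1.2, by have := mem_tubes.1 I.2; omega⟩)

theorem tubeDiagonal_fst (I : Tube (m + 1)) :
    (tubeDiagonal I).1.val = if I.1.1 = 1 then I.1.2 else I.1.1 - 2 := by
  unfold tubeDiagonal
  split_ifs <;> rfl

theorem tubeDiagonal_snd (I : Tube (m + 1)) :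
    (tubeDiagonal I).2.val = if I.1.1 = 1 then m + 2 else I.1.2 := by
  unfold tubeDiagonal
  split_ifs <;> rfl

theorem tubeDiagonal_injective : Function.Injective (tubeDiagonal (m := m)) := fun I J h => by
  have h1 := congrArg (fun d => d.1.val) h
  have h2 := congrArg (fun d => d.2.val) h
  simp only [tubeDiagonal_fst, tubeDiagonal_snd] at h1 h2
  have hI := mem_tubes.1 I.2
  have hJ := mem_tubes.1 J.2
  refine Subtype.ext (Prod.ext ?_ ?_) <;> split_ifs at h1 h2 <;> omega

theorem mem_diagonals {d : Fin (m + 3) × Fin (m + 3)} :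
    d ∈ diagonals (m + 3) ↔ d.1.val + 2 ≤ d.2.val ∧ ¬ (d.1.val = 0 ∧ d.2.val + 1 = m + 3) := by
  simp [diagonals]

theorem diagonals_eq_map :
    diagonals (m + 3) = Finset.univ.map ⟨tubeDiagonal, tubeDiagonal_injective⟩ := by
  ext d
  simp only [Finset.mem_map, Finset.mem_univ, true_and, Function.Embedding.coeFn_mk,
    mem_diagonals]
  constructor
  · intro h
    have hd2 := d.2.isLt
    by_cases h1 : d.2.val = m + 2
    · refine ⟨⟨(1, d.1.val), mem_tubes.2 (by simp only; omega)⟩, Prod.ext (Fin.ext ?_) (Fin.ext ?_)⟩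
      · simp [tubeDiagonal_fst]
      · simp [tubeDiagonal_snd, h1]
    · refine ⟨⟨(d.1.val + 2, d.2.val), mem_tubes.2 (by simp only; omega)⟩,
        Prod.ext (Fin.ext ?_) (Fin.ext ?_)⟩
      · simp [tubeDiagonal_fst]
      · simp [tubeDiagonal_snd]
  · rintro ⟨I, rfl⟩
    have hI := mem_tubes.1 I.2
    rw [tubeDiagonal_fst, tubeDiagonal_snd]
    split_ifs <;> omega

theorem tubeDiagonal_mem (I : Tube (m + 1)) : tubeDiagonal I ∈ diagonals (m + 3) := by
  simp [diagonals_eq_map]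

theorem exists_tubeDiagonal_eq {d : Fin (m + 3) × Fin (m + 3)} (hd : d ∈ diagonals (m + 3)) :
    ∃ I, tubeDiagonal I = d := by
  simpa [diagonals_eq_map] using hd

theorem crosses_tubeDiagonal (I J : Tube (m + 1)) :
    Crosses (tubeDiagonal I) (tubeDiagonal J) ↔ TubeCrosses I.1 J.1 := by
  have hI := mem_tubes.1 I.2
  have hJ := mem_tubes.1 J.2
  simp only [Crosses, Fin.lt_def, tubeDiagonal_fst, tubeDiagonal_snd, TubeCrosses]
  split_ifs <;> omega

theorem isTriangulation_map_iff (D : Finset (Tube (m + 1))) :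
    IsTriangulation (D.map ⟨tubeDiagonal, tubeDiagonal_injective⟩) ↔
      IsMaximalCompatible (fun d e : Tube (m + 1) => TubeCrosses d.1 e.1) D := by
  simp only [IsTriangulation, IsMaximalCompatible, diagonals_eq_map, Finset.forall_mem_map,
    Function.Embedding.coeFn_mk, crosses_tubeDiagonal, Finset.mem_univ, Finset.mem_map_mk,
    true_implies]
  refine ⟨fun h => ⟨h.2.1, fun d hd => ?_⟩, fun h => ⟨fun d _ => ?_, h.1, fun d hd => ?_⟩⟩
  · simpa [tubeDiagonal_injective.eq_iff] using h.2.2 d hd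
  · simp
  · simpa [tubeDiagonal_injective.eq_iff] using h.2 d hd

theorem phi3Amplitude_eq_sum
    [DecidablePred (IsMaximalCompatible fun d e : Tube (m + 1) => TubeCrosses d.1 e.1)]
    (s : kinematicSpace (m + 3)) :
    phi3Amplitude s = ∑ D with IsMaximalCompatible
      (fun d e : Tube (m + 1) => TubeCrosses d.1 e.1) D, ∏ d ∈ D, 1 / planarX s (tubeDiagonal d) := by
  unfold phi3Amplitude
  symm
  refine Finset.sum_bij (fun D _ => D.map ⟨tubeDiagonal, tubeDiagonal_injective⟩) (fun D hD => ?_)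
    (fun D _ D' _ h => Finset.map_injective _ h) (fun D hD => ?_) fun D hD => ?_
  · have h := (isTriangulation_map_iff D).2 ((Finset.mem_filter.1 hD).2)
    exact Finset.mem_filter.2 ⟨Finset.mem_powerset.2 h.1, h⟩
  · obtain ⟨h1, h2⟩ := Finset.mem_filter.1 hD
    rw [Finset.mem_powerset, diagonals_eq_map, Finset.subset_map_iff] at h1
    obtain ⟨D', -, rfl⟩ := h1
    exact ⟨D', by simpa using (isTriangulation_map_iff D').1 h2, rfl⟩
  · rw [Finset.prod_map]
    rfl

/-! ### Minors as interval sums, and the exponential change of variables. -/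

/-- The position of the point `σ_{k+1}` as a partial sum of the gaps. -/
theorem one_add_sum_eq_sum_expGap (t : Fin m → ℝ) {k : ℕ} (hk : 1 ≤ k) (hkm : k ≤ m + 1) :
    (1 + ∑ i : Fin m, if i.val + 1 < k then Real.exp (t i) else 0) =
      ∑ j ∈ Finset.Icc 1 k, expGap t j := by
  induction k, hk using Nat.le_induction with
  | base => simp [expGap_one]
  | succ k hk ih =>
    rw [Finset.sum_Icc_succ_top (by omega), ← ih (by omega), add_assoc]
    congr 1
    obtain ⟨i, hi⟩ : ∃ i : Fin m, i.val + 1 = k := ⟨⟨k - 1, by omega⟩, by simp only; omega⟩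
    have h1 : expGap t (k + 1) = ∑ j : Fin m, if j = i then Real.exp (t j) else 0 := by
      rw [Finset.sum_ite_eq' Finset.univ i, if_pos (Finset.mem_univ i), ← expGap_add_two, ← hi]
    rw [h1, ← Finset.sum_add_distrib]
    refine Finset.sum_congr rfl fun j _ => ?_
    have : j = i ↔ j.val + 1 = k := by rw [Fin.ext_iff]; omega
    simp only [this]
    split_ifs <;> first | omega | simp

theorem column_zero (t : Fin m → ℝ) (k : Fin (m + 3)) :
    column (n := m + 3) (fun i => Real.exp (t i)) k 0 = if k.val = m + 2 then 0 else 1 := by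
  unfold column
  by_cases h : k.val = m + 2
  · simp [h]
  · rw [if_neg (by omega), if_neg h]
    split_ifs <;> rfl

theorem column_one (t : Fin m → ℝ) (k : Fin (m + 3)) :
    column (n := m + 3) (fun i => Real.exp (t i)) k 1 =
      if k.val = m + 2 then 1 else ∑ j ∈ Finset.Icc 1 k.val, expGap t j := by
  unfold column
  by_cases h : k.val = m + 2
  · simp [h]
  · rw [if_neg (by omega), if_neg h]
    by_cases h0 : k.val = 0
    · simp [h0]
    · rw [if_neg h0, ← one_add_sum_eq_sum_expGap t (by omega) (by omega)]
      rfl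

theorem minor_eq (t : Fin m → ℝ) (i j : Fin (m + 3)) :
    minor (n := m + 3) (fun i => Real.exp (t i)) i j =
      (if i.val = m + 2 then 0 else 1) *
        (if j.val = m + 2 then 1 else ∑ k ∈ Finset.Icc 1 j.val, expGap t k) -
      (if j.val = m + 2 then 0 else 1) *
        (if i.val = m + 2 then 1 else ∑ k ∈ Finset.Icc 1 i.val, expGap t k) := by
  rw [minor, Matrix.det_fin_two_of, column_zero, column_zero, column_one, column_one]

theorem minor_of_lt (t : Fin m → ℝ) {i j : Fin (m + 3)} (hij : i.val < j.val) :
    minor (n := m + 3) (fun i => Real.exp (t i)) i j =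
      gapSum (m + 1) (expGap t) (i + 1) j := by
  have hi : i.val ≠ m + 2 := by omega
  rw [minor_eq, if_neg hi, if_neg hi]
  by_cases hj : j.val = m + 2
  · simp [hj, gapSum_right]
  · rw [if_neg hj, if_neg hj, gapSum_of_mem (by omega) (by omega), one_mul, one_mul,
      sub_eq_iff_eq_add']
    simp only [← Finset.Ico_add_one_right_eq_Icc]
    exact (Finset.sum_Ico_consecutive _ (by omega) (by omega)).symm

theorem minor_swap (t : Fin m → ℝ) (i j : Fin (m + 3)) :
    minor (n := m + 3) (fun i => Real.exp (t i)) i j =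
      -minor (n := m + 3) (fun i => Real.exp (t i)) j i := by
  rw [minor_eq, minor_eq]
  ring

theorem finRotate_val (i : Fin (m + 3)) :
    (finRotate (m + 3) i).val = if i.val = m + 2 then 0 else i.val + 1 := by
  rw [coe_finRotate]
  simp only [Fin.ext_iff, Fin.val_last]

theorem dihedralU_eq_tubeU (t : Fin m → ℝ) (I : Tube (m + 1)) :
    dihedralU (n := m + 3) (fun i => Real.exp (t i)) (tubeDiagonal I) =
      tubeU (m + 1) (expGap t) I.1 := by
  have hI := mem_tubes.1 I.2
  have h1 := tubeDiagonal_fst I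
  have h2 := tubeDiagonal_snd I
  set d := tubeDiagonal I
  have r1 := finRotate_val d.1
  have r2 := finRotate_val d.2
  unfold dihedralU tubeU
  by_cases h : I.1.1 = 1
  · rw [if_pos h] at h1 h2
    rw [if_pos h2] at r2
    rw [if_neg (by omega)] at r1
    -- Here the diagonal ends at the point at infinity, whose successor wraps around to 0. One minor
    -- in the numerator and one in the denominator are reversed, so the signs cancel.
    rw [minor_swap t d.1 (finRotate (m + 3) d.2),
      minor_swap t (finRotate (m + 3) d.1) (finRotate (m + 3) d.2),
      minor_of_lt t (by omega), minor_of_lt t (by omega), minor_of_lt t (by omega),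
      minor_of_lt t (by omega), r1, r2, h1, h2, h, gapSum_right, gapSum_right]
    simp only [Nat.sub_self, gapSum_zero_left, zero_add, mul_one, one_mul, mul_neg, neg_div_neg_eq]
  · rw [if_neg h] at h1 h2
    rw [if_neg (by omega)] at r1 r2
    rw [minor_of_lt t (by omega), minor_of_lt t (by omega), minor_of_lt t (by omega),
      minor_of_lt t (by omega), r1, r2, h1, h2, show I.1.1 - 2 + 1 = I.1.1 - 1 by omega,
      show I.1.1 - 1 + 1 = I.1.1 by omega]
    ring

theorem kobaNielsen_eq_monomial (s : kinematicSpace (m + 3)) (t : Fin m → ℝ) :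
    kobaNielsen (n := m + 3) s (fun i => Real.exp (t i)) =
      (tubeChart m).monomial (fun I => planarX s (tubeDiagonal I)) t := by
  rw [kobaNielsen, diagonals_eq_map, Finset.prod_map]
  refine Finset.prod_congr rfl fun I _ => ?_
  rw [Function.Embedding.coeFn_mk, dihedralU_eq_tubeU]
  rfl

theorem range_exp_eq : (fun t : Fin m → ℝ => fun i => Real.exp (t i)) '' univ =
    {x : Fin m → ℝ | ∀ i, 0 < x i} := by
  ext x
  simp only [image_univ, mem_range, mem_ofPred_eq]
  refine ⟨?_, fun h => ⟨fun i => Real.log (x i), funext fun i => Real.exp_log (h i)⟩⟩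
  rintro ⟨t, rfl⟩ i
  exact Real.exp_pos _

theorem hasFDerivAt_exp_pi (t : Fin m → ℝ) :
    HasFDerivAt (fun t : Fin m → ℝ => fun i => Real.exp (t i))
      (ContinuousLinearMap.pi fun i => (Real.exp (t i) • ContinuousLinearMap.id ℝ ℝ).comp
        (ContinuousLinearMap.proj (R := ℝ) (φ := fun _ : Fin m => ℝ) i)) t := by
  rw [hasFDerivAt_pi']
  intro i
  refine ((hasFDerivAt_apply i t).exp).congr_fderiv ?_
  ext v
  simp

theorem injective_exp_pi : Function.Injective fun t : Fin m → ℝ => fun i => Real.exp (t i) :=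
  fun _ _ h => funext fun i => Real.exp_injective (congrFun h i)

theorem abs_det_exp_pi (t : Fin m → ℝ) :
    |(ContinuousLinearMap.pi fun i => (Real.exp (t i) • ContinuousLinearMap.id ℝ ℝ).comp
        (ContinuousLinearMap.proj (R := ℝ) (φ := fun _ : Fin m => ℝ) i)).det| =
      ∏ i, Real.exp (t i) := by
  rw [ContinuousLinearMap.det_pi, Finset.abs_prod]
  refine Finset.prod_congr rfl fun i _ => ?_
  rw [ContinuousLinearMap.det, LinearMap.det_ring]
  simp

/-- The Jacobian of the exponential substitution cancels the factors 1/x_i of the Parke–Taylor form.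
-/
theorem smul_stringIntegrand (s : kinematicSpace (m + 3)) (t : Fin m → ℝ) :
    (∏ i, Real.exp (t i)) • stringIntegrand (n := m + 3) s (fun i => Real.exp (t i)) =
      (tubeChart m).monomial (fun I => planarX s (tubeDiagonal I)) t := by
  rw [stringIntegrand, kobaNielsen_eq_monomial, Complex.real_smul, mul_comm, mul_assoc]
  have : (∏ i : Fin (m + 3 - 3), ((Real.exp (t i) : ℝ) : ℂ)⁻¹) *
      ((∏ i, Real.exp (t i) : ℝ) : ℂ) = 1 := by
    rw [Complex.ofReal_prod]
    change (∏ i : Fin m, ((Real.exp (t i) : ℝ) : ℂ)⁻¹) * _ = 1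
    rw [← Finset.prod_mul_distrib]
    refine Finset.prod_eq_one fun i _ => inv_mul_cancel₀ ?_
    exact_mod_cast (Real.exp_pos _).ne'
  rw [this, mul_one]

theorem integrableOn_stringIntegrand {s : kinematicSpace (m + 3)}
    (hs : s ∈ convergenceChamber (m + 3)) :
    IntegrableOn (stringIntegrand s) (positivePart (m + 3)) := by
  -- `Fin (m + 3 - 3)` is definitionally `Fin m`; the change of variables is carried out over the
  -- latter.
  have key : IntegrableOn (fun x : Fin m → ℝ => stringIntegrand (n := m + 3) s x)
      {x : Fin m → ℝ | ∀ i, 0 < x i} := by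
    rw [← range_exp_eq, integrableOn_image_iff_integrableOn_abs_det_fderiv_smul volume
      MeasurableSet.univ (fun t _ => (hasFDerivAt_exp_pi t).hasFDerivWithinAt)
      injective_exp_pi.injOn, integrableOn_univ]
    refine ((tubeChart m).integrable_monomial fun I => hs _ (tubeDiagonal_mem I)).congr
      (ae_of_all _ fun t => ?_)
    beta_reduce
    rw [abs_det_exp_pi]
    exact (smul_stringIntegrand s t).symm
  exact key

theorem stringIntegral_eq_integral (s : kinematicSpace (m + 3)) :
    stringIntegral s = (tubeChart m).integral fun I => planarX s (tubeDiagonal I) := by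
  have key : ∫ x in {x : Fin m → ℝ | ∀ i, 0 < x i}, stringIntegrand (n := m + 3) s x =
      (tubeChart m).integral fun I => planarX s (tubeDiagonal I) := by
    rw [← range_exp_eq, integral_image_eq_integral_abs_det_fderiv_smul volume
      MeasurableSet.univ (fun t _ => (hasFDerivAt_exp_pi t).hasFDerivWithinAt)
      injective_exp_pi.injOn, setIntegral_univ]
    refine integral_congr_ae (ae_of_all _ fun t => ?_)
    beta_reduce
    rw [abs_det_exp_pi]
    exact smul_stringIntegrand s t
  exact key

end

/-! ### Kinematic space and uniqueness of the continuation. -/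

section

variable {m : ℕ}

/-- `planarX` as a continuous linear functional. -/
noncomputable def planarXCLM {n : ℕ} (d : Fin n × Fin n) : kinematicSpace n →L[ℂ] ℂ :=
  LinearMap.toContinuousLinearMap
    { toFun := fun s => planarX s d
      map_add' := fun s t => by
        simp only [planarX, ← Finset.sum_add_distrib]
        refine Finset.sum_congr rfl fun a _ => Finset.sum_congr rfl fun b _ => ?_
        split_ifs <;> simp
      map_smul' := fun c s => by
        simp only [planarX, RingHom.id_apply, smul_eq_mul, Finset.mul_sum]
        refine Finset.sum_congr rfl fun a _ => Finset.sum_congr rfl fun b _ => ?_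
        split_ifs <;> simp }

theorem planarX_smul {n : ℕ} (c : ℂ) (s : kinematicSpace n) (d : Fin n × Fin n) :
    planarX (c • s) d = c * planarX s d := (planarXCLM d).map_smul c s

theorem fin_add_one_ne_self (a : Fin (m + 3)) : a ≠ a + 1 := fun h => by
  have h1 := congrArg Fin.val h
  rw [Fin.val_add_one] at h1
  split_ifs at h1 with h2
  · rw [h2, Fin.val_last] at h1
    omega
  · omega

/-- A point of the chamber: the Mandelstam variable is `m` for neighbouring particles and `-2`
for all others. -/
def chamberPoint (m : ℕ) : kinematicSpace (m + 3) where
  val a b := -2 + (if a = b then 2 else 0) + (if b = a + 1 then (m : ℂ) + 2 else 0) +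
    if a = b + 1 then (m : ℂ) + 2 else 0
  property := by
    -- Row sums vanish because each particle has two neighbours contributing m and m others
    -- contributing -2.
    refine ⟨fun a b => ?_, fun a => ?_, fun a => ?_⟩
    · simp only [eq_comm (a := a) (b := b)]
      ring
    · simp [fin_add_one_ne_self a]
    · have h : ∀ b, a = b + 1 ↔ b = a - 1 := fun b => by rw [eq_sub_iff_add_eq, eq_comm]
      simp only [Finset.sum_add_distrib, h]
      simp
      ring

/-- Among k + 1 consecutive indices there are k neighbouring pairs and k(k+1)/2 pairs in all, giving
kc - k(k+1). -/
theorem sum_Ico_sum_Ico_eq (i k : ℕ) (c : ℝ) :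
    ∑ a ∈ Finset.Ico i (i + k + 1), ∑ b ∈ Finset.Ico (a + 1) (i + k + 1),
      ((-2 : ℝ) + if b = a + 1 then c else 0) = k * (c - 1 - k) := by
  induction k with
  | zero => simp
  | succ k ih =>
    rw [show i + (k + 1) + 1 = i + k + 1 + 1 by ring, Finset.sum_Ico_succ_top (by omega),
      Finset.Ico_self, Finset.sum_empty, add_zero]
    have h1 : ∀ a ∈ Finset.Ico i (i + k + 1), ∑ b ∈ Finset.Ico (a + 1) (i + k + 1 + 1),
        ((-2 : ℝ) + if b = a + 1 then c else 0) = ∑ b ∈ Finset.Ico (a + 1) (i + k + 1),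
          ((-2 : ℝ) + if b = a + 1 then c else 0) + (-2 + if i + k = a then c else 0) :=
      fun a ha => by
      have ha := Finset.mem_Ico.1 ha
      rw [Finset.sum_Ico_succ_top (by omega)]
      simp only [Nat.add_right_cancel_iff]
    rw [Finset.sum_congr rfl h1, Finset.sum_add_distrib, ih, Finset.sum_add_distrib,
      Finset.sum_ite_eq, if_pos (by simp)]
    simp only [Finset.sum_const, Nat.card_Ico, nsmul_eq_mul]
    rw [show i + k + 1 - i = k + 1 by omega]
    push_cast
    ring

/-- Shows that the chamber is nonempty and supplies the base point, with real positive values, for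
the identity theorem on kinematic space. -/
theorem planarX_chamberPoint {d : Fin (m + 3) × Fin (m + 3)} (hd : d ∈ diagonals (m + 3)) :
    ∃ c : ℝ, 0 < c ∧ planarX (chamberPoint m) d = c := by
  obtain ⟨h1, h2⟩ := mem_diagonals.1 hd
  obtain ⟨k, hk⟩ : ∃ k, d.2.val = d.1.val + (k + 1) + 1 := ⟨d.2.val - d.1.val - 2, by omega⟩
  have hkm : k + 1 ≤ m := by have := d.2.isLt; omega
  refine ⟨((k + 1 : ℕ) : ℝ) * ((m + 2 : ℝ) - 1 - (k + 1 : ℕ)), ?_, ?_⟩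
  · have : ((k + 1 : ℕ) : ℝ) ≤ m := by exact_mod_cast hkm
    have h3 : (0 : ℝ) < (k + 1 : ℕ) := by positivity
    exact mul_pos h3 (by linarith)
  · rw [← sum_Ico_sum_Ico_eq d.1.val (k + 1) (m + 2), ← hk]
    have hsub : ∀ (i : ℕ) (f : ℕ → ℂ), ∑ b ∈ Finset.Ico i d.2.val, f b =
        ∑ b : Fin (m + 3), if i ≤ b.val ∧ b.val < d.2.val then f b else 0 := fun i f => by
      rw [Fin.sum_univ_eq_sum_range (fun b => if i ≤ b ∧ b < d.2.val then f b else 0),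
        ← Finset.sum_filter]
      congr 1
      ext b
      have := d.2.isLt
      simp only [Finset.mem_Ico, Finset.mem_filter, Finset.mem_range]
      omega
    push_cast
    rw [hsub, planarX]
    refine Finset.sum_congr rfl fun a _ => ?_
    rw [hsub]
    by_cases ha : d.1.val ≤ a.val ∧ a.val < d.2.val
    · rw [if_pos ha]
      refine Finset.sum_congr rfl fun b _ => ?_
      have hiff : (d.1 ≤ a ∧ a < b ∧ b < d.2) ↔ (a.val + 1 ≤ b.val ∧ b.val < d.2.val) := by
        simp only [Fin.le_def, Fin.lt_def]
        omega
      simp only [hiff]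
      by_cases h : a.val + 1 ≤ b.val ∧ b.val < d.2.val
      · rw [if_pos h, if_pos h]
        have e1 : a ≠ b := fun h' => by subst h'; omega
        have e2 : b = a + 1 ↔ b.val = a.val + 1 := by
          rw [Fin.ext_iff, Fin.val_add_one_of_lt' (by omega)]
        have e3 : a ≠ b + 1 := fun h' => by
          have := congrArg Fin.val h'
          rw [Fin.val_add_one_of_lt' (by omega)] at this
          omega
        simp only [chamberPoint, if_neg e1, if_neg e3, e2]
        split_ifs <;> simp
      · rw [if_neg h, if_neg h]
    · rw [if_neg ha]
      refine Finset.sum_eq_zero fun b _ => if_neg ?_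
      simp only [Fin.le_def, Fin.lt_def]
      omega

theorem regularSet_eq : regularSet (m + 3) = univ ∩ {s | ∀ I : Tube (m + 1), ∀ k : ℕ,
    planarXCLM (tubeDiagonal I) s ≠ -(k : ℂ)} := by
  ext s
  rw [univ_inter]
  refine ⟨fun h I => h _ (tubeDiagonal_mem I), fun h d hd => ?_⟩
  obtain ⟨I, rfl⟩ := exists_tubeDiagonal_eq hd
  exact h I

theorem eqOn_regularSet {F F' : kinematicSpace (m + 3) → ℂ} (hF : IsAnalyticContinuation F)
    (hF' : IsAnalyticContinuation F') : EqOn F F' (regularSet (m + 3)) := by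
  choose c hc hc' using fun I : Tube (m + 1) => planarX_chamberPoint (tubeDiagonal_mem I)
  have h1 := hF.holomorphic
  have h2 := hF'.holomorphic
  rw [regularSet_eq] at h1 h2 ⊢
  refine eqOn_of_eqOn_chamber (fun I : Tube (m + 1) => planarXCLM (tubeDiagonal I)) isOpen_univ
    convex_univ (fun _ _ => mem_univ _) hc hc' h1 h2 fun s hs => ?_
  have hs' : s ∈ convergenceChamber (m + 3) := fun d hd => by
    obtain ⟨I, rfl⟩ := exists_tubeDiagonal_eq hd
    exact hs I
  rw [hF.eq_integral s hs', hF'.eq_integral s hs']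

theorem isAnalyticContinuation_comp_planarX {G : (Tube (m + 1) → ℂ) → ℂ}
    (hG : DifferentiableOn ℂ G {X | ∀ d, ∀ k : ℕ, X d ≠ -(k : ℂ)})
    (hGJ : ∀ X : Tube (m + 1) → ℂ, (∀ d, 0 < (X d).re) → G X = (tubeChart m).integral X) :
    IsAnalyticContinuation fun s : kinematicSpace (m + 3) =>
      G fun I => planarX s (tubeDiagonal I) where
  holomorphic := by
    have h : Differentiable ℂ fun s : kinematicSpace (m + 3) => fun I : Tube (m + 1) =>
        planarX s (tubeDiagonal I) :=
      differentiable_pi.2 fun I => (planarXCLM (tubeDiagonal I)).differentiable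
    exact hG.comp h.differentiableOn fun s hs I => hs _ (tubeDiagonal_mem I)
  eq_integral s hs := by
    rw [hGJ _ fun I => hs _ (tubeDiagonal_mem I), stringIntegral_eq_integral]

theorem eventually_smul_mem_regularSet {s : kinematicSpace (m + 3)}
    (hs : ∀ d ∈ diagonals (m + 3), planarX s d ≠ 0) :
    ∀ᶠ α : ℂ in 𝓝[≠] 0, α • s ∈ regularSet (m + 3) := by
  have h1 : ∀ᶠ α : ℂ in 𝓝 0, ∀ I : Tube (m + 1), ‖α * planarX s (tubeDiagonal I)‖ < 1 := by
    rw [eventually_all]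
    intro I
    have : Continuous fun α : ℂ => ‖α * planarX s (tubeDiagonal I)‖ := by fun_prop
    exact this.continuousAt.eventually_lt continuousAt_const (by simp)
  filter_upwards [h1.filter_mono nhdsWithin_le_nhds, self_mem_nhdsWithin] with α hα hα0 d hd k h
  obtain ⟨I, rfl⟩ := exists_tubeDiagonal_eq hd
  have h2 := hα I
  rw [planarX_smul] at h
  rw [h, norm_neg, Complex.norm_natCast] at h2
  have hk : k = 0 := by
    have : k < 1 := by exact_mod_cast h2
    omega
  subst hk
  have hα0 : α ≠ 0 := hα0
  simp [hα0, hs _ hd] at h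

end

theorem mainTheorem5 (n : ℕ) (hn : 3 ≤ n) :
    (∀ s ∈ convergenceChamber n, IntegrableOn (stringIntegrand s) (positivePart n)) ∧
    (∃ F : kinematicSpace n → ℂ, IsAnalyticContinuation F) ∧
    ∀ F : kinematicSpace n → ℂ, IsAnalyticContinuation F →
      ∀ s : kinematicSpace n, (∀ d ∈ diagonals n, planarX s d ≠ 0) →
        Tendsto (fun α' : ℂ => openStringAmplitude F α' s) (𝓝[≠] 0) (𝓝 (phi3Amplitude s)) := by
  classical
  obtain ⟨m, rfl⟩ : ∃ m, n = m + 3 := ⟨n - 3, by omega⟩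
  obtain ⟨G, hG, hGJ⟩ := (tubeChart m).exists_continuation
  have hG' := isAnalyticContinuation_comp_planarX hG hGJ
  refine ⟨fun s hs => integrableOn_stringIntegrand hs, ⟨_, hG'⟩, fun F hF s hs => ?_⟩
  rw [phi3Amplitude_eq_sum]
  refine (tendsto_pow_mul_continuation_tubeChart hG hGJ
    (X := fun I => planarX s (tubeDiagonal I)) fun I => hs _ (tubeDiagonal_mem I)).congr' ?_
  -- For small nonzero α the point α • s is regular, so an arbitrary continuation `F` may be
  -- replaced by the one constructed from `G`.
  filter_upwards [eventually_smul_mem_regularSet hs] with α hα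
  rw [openStringAmplitude, eqOn_regularSet hF hG' hα, Nat.add_sub_cancel]
  simp only [planarX_smul]
  rfl
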